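/- Let $N\ge 3$, let $\Omega\subset\mathbb{R}^N$ be a bounded domain, let $1<q\le 2$, $\lambda\le 0$, $h\in L^1_{\rm loc}(\Omega)$, and let $g:\Omega\times(0,+\infty)\to[0,+\infty)$ be such that $s\mapsto g(x,s)$ is nonincreasing for a.e. $x\in\Omega$ and $x\mapsto g(x,s)$ is measurable and locally essentially bounded in $\Omega$ for every $s>0$. Let $u,v\in C(\Omega)\cap W^{1,N}_{\rm loc}(\Omega)$ with $u,v>0$ in $\Omega$, such that $g(\cdot,u)|\nabla u|^q$ and $g(\cdot,v)|\nabla v|^q$ are measurable in $\Omega$ and $$\int_\Omega \nabla u\cdot\nabla\phi\le \lambda\int_\Omega u\phi+\int_\Omega g(x,u)|\nabla u|^q\phi+\int_\Omega h\phi,$$ $$\int_\Omega \nabla v\cdot\nabla\phi\ge \lambda\int_\Omega v\phi+\int_\Omega g(x,v)|\nabla v|^q\phi+\int_\Omega h\phi$$ for every $0\le\phi\in H^1_0(\Omega)\cap L^\infty(\Omega)$ with compact support in $\Omega$. Suppose also that $$\limsup_{x\to x_0}\,(u(x)-v(x))\le 0\qquad\text{for every } x_0\in\partial\Omega .$$ Then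 $u\le v$ in $\Omega$. -/

import Mathlib

open MeasureTheory Filter Topology
open scoped ENNReal ContDiff

noncomputable section

/-- Smooth functions on `ℝ^N` whose support is a compact subset of `Ω`, i.e. `C_c^∞(Ω)`. -/
structure IsTestFunction {N : ℕ} (Ω : Set (EuclideanSpace ℝ (Fin N)))
    (ψ : EuclideanSpace ℝ (Fin N) → ℝ) : Prop where
  smooth : ContDiff ℝ ∞ ψ
  compact_support : HasCompactSupport ψ
  support_subset : tsupport ψ ⊆ Ω

/-- `Du` is a weak (distributional) gradient of `u` in the open set `Ω`. -/
structure HasWeakGradient {N : ℕ} (Ω : Set (EuclideanSpace ℝ (Fin N)))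
    (u : EuclideanSpace ℝ (Fin N) → ℝ)
    (Du : EuclideanSpace ℝ (Fin N) → EuclideanSpace ℝ (Fin N)) : Prop where
  locallyIntegrable : LocallyIntegrableOn u Ω volume
  locallyIntegrable_grad : LocallyIntegrableOn Du Ω volume
  integral_eq : ∀ ψ : EuclideanSpace ℝ (Fin N) → ℝ, IsTestFunction Ω ψ →
    ∀ e : EuclideanSpace ℝ (Fin N),
      ∫ x in Ω, u x * fderiv ℝ ψ x e = - ∫ x in Ω, inner ℝ (Du x) e * ψ x

/-- `f ∈ L^p_loc(Ω)`: `f` belongs to `L^p(K)` for every compact `K ⊆ Ω`. -/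
def MemLpLoc {N : ℕ} {F : Type*} [NormedAddCommGroup F] (p : ℝ≥0∞)
    (Ω : Set (EuclideanSpace ℝ (Fin N))) (f : EuclideanSpace ℝ (Fin N) → F) : Prop :=
  ∀ K : Set (EuclideanSpace ℝ (Fin N)), IsCompact K → K ⊆ Ω →
    MemLp f p (volume.restrict K)

/-- `u ∈ W^{1,p}_loc(Ω)`, with weak gradient `Du`. -/
structure MemW1pLoc {N : ℕ} (p : ℝ≥0∞) (Ω : Set (EuclideanSpace ℝ (Fin N)))
    (u : EuclideanSpace ℝ (Fin N) → ℝ)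
    (Du : EuclideanSpace ℝ (Fin N) → EuclideanSpace ℝ (Fin N)) : Prop where
  hasWeakGradient : HasWeakGradient Ω u Du
  memLpLoc : MemLpLoc p Ω u
  memLpLoc_grad : MemLpLoc p Ω Du

/-- `φ ∈ H_0^1(Ω)`, with weak gradient `Dφ`: `φ` belongs to `H^1(Ω)` and is the limit in the norm
of `H^1(Ω)` of a sequence in `C_c^∞(Ω)`. -/
structure MemH10 {N : ℕ} (Ω : Set (EuclideanSpace ℝ (Fin N)))
    (φ : EuclideanSpace ℝ (Fin N) → ℝ)
    (Dφ : EuclideanSpace ℝ (Fin N) → EuclideanSpace ℝ (Fin N)) : Prop where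
  memLp : MemLp φ 2 (volume.restrict Ω)
  memLp_grad : MemLp Dφ 2 (volume.restrict Ω)
  hasWeakGradient : HasWeakGradient Ω φ Dφ
  exists_approx : ∃ ψ : ℕ → EuclideanSpace ℝ (Fin N) → ℝ,
    (∀ n, IsTestFunction Ω (ψ n)) ∧
    Tendsto (fun n => eLpNorm (fun x => ψ n x - φ x) 2 (volume.restrict Ω)) atTop (𝓝 0) ∧
    Tendsto (fun n => eLpNorm (fun x => gradient (ψ n) x - Dφ x) 2 (volume.restrict Ω))
      atTop (𝓝 0)

/-- `0 ≤ φ ∈ H_0^1(Ω) ∩ L^∞(Ω)` with compact support in `Ω`, with weak gradient `Dφ`. Since `φ`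
is defined up to null sets, its support is understood in the essential sense. -/
structure IsAdmissible {N : ℕ} (Ω : Set (EuclideanSpace ℝ (Fin N)))
    (φ : EuclideanSpace ℝ (Fin N) → ℝ)
    (Dφ : EuclideanSpace ℝ (Fin N) → EuclideanSpace ℝ (Fin N)) : Prop where
  memH10 : MemH10 Ω φ Dφ
  memLp_top : MemLp φ ∞ (volume.restrict Ω)
  nonneg : ∀ᵐ x ∂(volume.restrict Ω), 0 ≤ φ x
  compact_support : ∃ K : Set (EuclideanSpace ℝ (Fin N)), IsCompact K ∧ K ⊆ Ω ∧
    ∀ᵐ x ∂(volume.restrict Ω), x ∉ K → φ x = 0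

/-- `u`, with weak gradient `Du`, satisfies `-Δu ≤ λ u + g(x,u)|∇u|^q + h` weakly in `Ω`. -/
def IsWeakSubsolution {N : ℕ} (Ω : Set (EuclideanSpace ℝ (Fin N))) (q lam : ℝ)
    (g : EuclideanSpace ℝ (Fin N) → ℝ → ℝ) (h u : EuclideanSpace ℝ (Fin N) → ℝ)
    (Du : EuclideanSpace ℝ (Fin N) → EuclideanSpace ℝ (Fin N)) : Prop :=
  ∀ (φ : EuclideanSpace ℝ (Fin N) → ℝ)
    (Dφ : EuclideanSpace ℝ (Fin N) → EuclideanSpace ℝ (Fin N)), IsAdmissible Ω φ Dφ →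
    ∫ x in Ω, inner ℝ (Du x) (Dφ x) ≤
      lam * (∫ x in Ω, u x * φ x) + (∫ x in Ω, g x (u x) * ‖Du x‖ ^ q * φ x)
        + ∫ x in Ω, h x * φ x

/-- `v`, with weak gradient `Dv`, satisfies `-Δv ≥ λ v + g(x,v)|∇v|^q + h` weakly in `Ω`. -/
def IsWeakSupersolution {N : ℕ} (Ω : Set (EuclideanSpace ℝ (Fin N))) (q lam : ℝ)
    (g : EuclideanSpace ℝ (Fin N) → ℝ → ℝ) (h v : EuclideanSpace ℝ (Fin N) → ℝ)
    (Dv : EuclideanSpace ℝ (Fin N) → EuclideanSpace ℝ (Fin N)) : Prop :=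
  ∀ (φ : EuclideanSpace ℝ (Fin N) → ℝ)
    (Dφ : EuclideanSpace ℝ (Fin N) → EuclideanSpace ℝ (Fin N)), IsAdmissible Ω φ Dφ →
    lam * (∫ x in Ω, v x * φ x) + (∫ x in Ω, g x (v x) * ‖Dv x‖ ^ q * φ x)
        + (∫ x in Ω, h x * φ x) ≤
      ∫ x in Ω, inner ℝ (Dv x) (Dφ x)

end

/-! Suppose `u > v` somewhere. The boundary condition makes the superlevel sets of `w = u - v` at
positive levels compact in `Ω`, so `w` attains a maximum `M > 0`. For `k` just below `M` put `m = (w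
- k)⁺` and test both inequalities with `m³`. The terms in `h` cancel, and the term in `λ ≤ 0` has
the favourable sign. Since `g` is nonincreasing in `s`, on `{u > v}` the difference of the gradient
terms is at most `g(x,u) (|∇u|^q - |∇v|^q)`. As `q ≤ 2` and `g(x,u)` is locally bounded, this is at
most `B |∇w|` with `B = 2C(1 + |∇u|)`, locally in `L^N` (`Real.rpow_sub_rpow_le`,
`exists_coeff_le`). With `X = m ∇w` this gives `∫ |X|² ≤ ∫ B |X| m²` (`energy_le`).

Since `∇(m²) = 2X`, Sobolev's inequality and Hölder with exponents `N`, `2`, `2N/(N-2)` bound the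
right side by a constant times `‖B‖ ‖X‖²`, where the `L^N` norm of `B` is taken only over `{w > k,
∇w ≠ 0}`. These sets shrink to `{w = M, ∇w ≠ 0}` as `k → M`, which is null because a weak gradient
vanishes almost everywhere on a level set (`grad_eq_zero_of_level`). Hence for `k` close to `M` the
right side is absorbed, `X = 0`, and `w ≤ k < M` everywhere, contradicting that `M` is attained
(`exists_le_of_energy_le`).

All Sobolev calculus takes place on the whole space, for the compactly supported function `f = η w`
with a cutoff `η`; mollification supplies the chain rule, Sobolev's inequality and membership in
`H¹₀`. -/

open scoped Convolution

/-! ### Translations and averages in `L²`. -/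

/-- Translations act continuously on `L²`. -/
theorem tendsto_eLpNorm_translate_sub {E F : Type*} [NormedAddCommGroup E] [NormedSpace ℝ E]
    [FiniteDimensional ℝ E] [MeasurableSpace E] [BorelSpace E] [NormedAddCommGroup F]
    (μ : Measure E) [μ.IsAddHaarMeasure] {f : E → F} (hf : MemLp f 2 μ) :
    Tendsto (fun y => eLpNorm (fun x => f (x - y) - f x) 2 μ) (𝓝 0) (𝓝 0) := by
  have hmp : ∀ y : E, MeasurePreserving (fun x => x - y) μ μ := fun y =>
    measurePreserving_sub_right μ y
  let g : E → C(E, E) := fun y => ⟨fun x => x - y, by fun_prop⟩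
  have hg : Continuous g := by
    refine ContinuousMap.continuous_of_continuous_uncurry _ ?_
    change Continuous fun p : E × E => p.2 - p.1
    fun_prop
  have h1 : Continuous (fun y => Lp.compMeasurePreserving (g y) (hmp y) (hf.toLp f)) :=
    (continuous_const (y := hf.toLp f)).compMeasurePreservingLp hg hmp (by simp)
  have h2 := (h1.tendsto 0)
  rw [Lp.tendsto_Lp_iff_tendsto_eLpNorm'] at h2
  refine h2.congr fun y => eLpNorm_congr_ae ?_
  have e1 := Lp.coeFn_compMeasurePreserving (hf.toLp f) (hmp y)
  have e0 := Lp.coeFn_compMeasurePreserving (hf.toLp f) (hmp 0)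
  have e2 := (hmp y).quasiMeasurePreserving.ae_eq_comp hf.coeFn_toLp
  filter_upwards [e1, e0, e2, hf.coeFn_toLp] with x h1 h0 h2 h3
  simp only [Pi.sub_apply]
  change (Lp.compMeasurePreserving (fun x => x - y) (hmp y) (hf.toLp f)) x -
    (Lp.compMeasurePreserving (fun x => x - 0) (hmp 0) (hf.toLp f)) x = _
  rw [h1, h0]
  simp only [Function.comp_apply, sub_zero] at h2 ⊢
  rw [h2, h3]

/-- The `L²` distance between a function and its average against a probability density is
controlled by its `L²` modulus of continuity. -/
theorem eLpNorm_convolution_sub_le {E F : Type*} [NormedAddCommGroup E] [NormedSpace ℝ E]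
    [FiniteDimensional ℝ E] [MeasurableSpace E] [BorelSpace E] [NormedAddCommGroup F]
    [NormedSpace ℝ F] [CompleteSpace F]
    (μ : Measure E) [μ.IsAddHaarMeasure] {f : E → F} (hf : MemLp f 2 μ) {ρ : E → ℝ}
    (hρc : Continuous ρ) (hρs : HasCompactSupport ρ) (hρ0 : ∀ x, 0 ≤ ρ x) (hρ1 : ∫ x, ρ x ∂μ = 1)
    {ε : ℝ≥0∞} (hε : ∀ y ∈ Function.support ρ, eLpNorm (fun x => f (x - y) - f x) 2 μ ≤ ε) :
    eLpNorm (fun x => (ρ ⋆[ContinuousLinearMap.lsmul ℝ ℝ, μ] f) x - f x) 2 μ ≤ ε := by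
  have hρi : Integrable ρ μ := hρc.integrable_of_hasCompactSupport hρs
  have hρl : ∫⁻ y, ENNReal.ofReal (ρ y) ∂μ = 1 := by
    rw [← ofReal_integral_eq_lintegral_ofReal hρi (ae_of_all _ hρ0), hρ1, ENNReal.ofReal_one]
  have hρm : Measurable fun y => ENNReal.ofReal (ρ y) := hρc.measurable.ennreal_ofReal
  -- Against the probability measure `ρ μ`, Jensen's inequality for the square is the monotonicity
  -- of `L^p` norms in `p`.
  set ν : Measure E := μ.withDensity fun y => ENNReal.ofReal (ρ y) with hν
  have hνp : IsProbabilityMeasure ν := ⟨by rw [hν, withDensity_apply _ MeasurableSet.univ]; simpa using hρl⟩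
  have hνμ : ν ≪ μ := withDensity_absolutelyContinuous _ _
  have hli : LocallyIntegrable f μ := hf.locallyIntegrable (by norm_num)
  have hexi : ConvolutionExists ρ f (ContinuousLinearMap.lsmul ℝ ℝ) μ :=
    hρs.convolutionExists_left _ hρc hli
  have hprod : AEStronglyMeasurable (fun p : E × E => f (p.1 - p.2) - f p.1) (μ.prod μ) := by
    refine AEStronglyMeasurable.sub ?_ ?_
    · exact hf.1.comp_quasiMeasurePreserving (quasiMeasurePreserving_sub_of_right_invariant μ μ)
    · exact hf.1.comp_fst
  have hsec : ∀ x, AEStronglyMeasurable (fun y => f (x - y) - f x) μ := fun x =>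
    (hf.1.comp_quasiMeasurePreserving
      (quasiMeasurePreserving_sub_left_of_right_invariant μ x)).sub aestronglyMeasurable_const
  have hpt : ∀ x, ‖(ρ ⋆[ContinuousLinearMap.lsmul ℝ ℝ, μ] f) x - f x‖ₑ ^ (2 : ℝ)
      ≤ ∫⁻ y, ENNReal.ofReal (ρ y) * ‖f (x - y) - f x‖ₑ ^ (2 : ℝ) ∂μ := by
    intro x
    have h1 : (ρ ⋆[ContinuousLinearMap.lsmul ℝ ℝ, μ] f) x - f x
        = ∫ y, (f (x - y) - f x) ∂ν := by
      have hnn : (fun y => ENNReal.ofReal (ρ y)) = fun y => ((Real.toNNReal (ρ y) : NNReal) : ℝ≥0∞) := rfl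
      rw [hν, hnn, integral_withDensity_eq_integral_smul hρc.measurable.real_toNNReal]
      have : ∀ y, (Real.toNNReal (ρ y)) • (f (x - y) - f x) = ρ y • f (x - y) - ρ y • f x := by
        intro y
        rw [NNReal.smul_def, Real.coe_toNNReal _ (hρ0 y), smul_sub]
      simp_rw [this]
      have hx : Integrable (fun y => ρ y • f (x - y)) μ := hexi x
      rw [integral_sub hx (hρi.smul_const _), integral_smul_const, hρ1, one_smul]
      rfl
    have h2 : ‖∫ y, (f (x - y) - f x) ∂ν‖ₑ ≤ eLpNorm (fun y => f (x - y) - f x) 2 ν := by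
      refine (enorm_integral_le_lintegral_enorm _).trans ?_
      rw [← eLpNorm_one_eq_lintegral_enorm]
      exact eLpNorm_le_eLpNorm_of_exponent_le (by norm_num) ((hsec x).mono_ac hνμ)
    rw [h1]
    refine (ENNReal.rpow_le_rpow h2 (by norm_num)).trans ?_
    rw [eLpNorm_eq_lintegral_rpow_enorm_toReal (by norm_num) (by norm_num), ← ENNReal.rpow_mul]
    simp only [ENNReal.toReal_ofNat, one_div, ne_eq, OfNat.ofNat_ne_zero, not_false_eq_true, inv_mul_cancel₀, ENNReal.rpow_one]
    rw [hν, lintegral_withDensity_eq_lintegral_mul₀' hρm.aemeasurable]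
    · rfl
    · exact (((hsec x).mono_ac hνμ).enorm.pow_const _)
  rw [eLpNorm_eq_lintegral_rpow_enorm_toReal (by norm_num) (by norm_num)]
  simp only [ENNReal.toReal_ofNat]
  -- By Tonelli the inner integral is in `x`; the modulus of continuity is needed only where the
  -- weight `ρ y` is nonzero.
  have key : ∫⁻ x, ‖(ρ ⋆[ContinuousLinearMap.lsmul ℝ ℝ, μ] f) x - f x‖ₑ ^ (2 : ℝ) ∂μ ≤ ε ^ (2 : ℝ) := by
    calc _ ≤ ∫⁻ x, ∫⁻ y, ENNReal.ofReal (ρ y) * ‖f (x - y) - f x‖ₑ ^ (2 : ℝ) ∂μ ∂μ :=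
          lintegral_mono hpt
      _ = ∫⁻ y, ∫⁻ x, ENNReal.ofReal (ρ y) * ‖f (x - y) - f x‖ₑ ^ (2 : ℝ) ∂μ ∂μ := by
          refine lintegral_lintegral_swap ?_
          exact (hρm.comp measurable_snd).aemeasurable.mul (hprod.enorm.pow_const _)
      _ ≤ ∫⁻ y, ENNReal.ofReal (ρ y) * ε ^ (2 : ℝ) ∂μ := by
          refine lintegral_mono fun y => ?_
          rw [lintegral_const_mul' _ _ ENNReal.ofReal_ne_top]
          by_cases hy : y ∈ Function.support ρ
          · gcongr
            have := hε y hy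
            rw [eLpNorm_eq_lintegral_rpow_enorm_toReal (by norm_num) (by norm_num)] at this
            have := ENNReal.rpow_le_rpow this (z := 2) (by norm_num)
            rw [← ENNReal.rpow_mul] at this
            simpa using this
          · simp [Function.notMem_support.1 hy]
      _ = ε ^ (2 : ℝ) := by
          rw [lintegral_mul_const _ hρm, hρl, one_mul]
  calc _ ≤ (ε ^ (2 : ℝ)) ^ (1 / 2 : ℝ) := ENNReal.rpow_le_rpow key (by norm_num)
    _ = ε := by rw [← ENNReal.rpow_mul]; norm_num

/-! ### Compactly supported Sobolev functions and their mollification. -/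

/-- `f` is continuous with compact support, and `Df` is a square integrable weak gradient of `f`
on the whole space. -/
structure IsCompactSobolev {N : ℕ} (f : EuclideanSpace ℝ (Fin N) → ℝ)
    (Df : EuclideanSpace ℝ (Fin N) → EuclideanSpace ℝ (Fin N)) : Prop where
  continuous : Continuous f
  hasCompactSupport : HasCompactSupport f
  memLp_grad : MemLp Df 2 volume
  integral_eq : ∀ ψ : EuclideanSpace ℝ (Fin N) → ℝ, ContDiff ℝ ∞ ψ → HasCompactSupport ψ →
    ∀ e : EuclideanSpace ℝ (Fin N),
      ∫ x, f x * fderiv ℝ ψ x e = - ∫ x, inner ℝ (Df x) e * ψ x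

/-- The gradient of a mollification is the mollification of the weak gradient. -/
theorem gradient_convolution {N : ℕ} {f : EuclideanSpace ℝ (Fin N) → ℝ}
    {Df : EuclideanSpace ℝ (Fin N) → EuclideanSpace ℝ (Fin N)} (hf : IsCompactSobolev f Df)
    {ρ : EuclideanSpace ℝ (Fin N) → ℝ} (hρ : ContDiff ℝ ∞ ρ) (hρs : HasCompactSupport ρ)
    (x : EuclideanSpace ℝ (Fin N)) :
    gradient (ρ ⋆[ContinuousLinearMap.lsmul ℝ ℝ] f) x
      = (ρ ⋆[ContinuousLinearMap.lsmul ℝ ℝ] Df) x := by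
  refine ext_inner_right ℝ fun e => ?_
  have hfi : LocallyIntegrable f := hf.continuous.locallyIntegrable
  have hDi : LocallyIntegrable Df := hf.memLp_grad.locallyIntegrable (by norm_num)
  rw [inner_gradient_left, ← convolution_flip,
    (hρs.hasFDerivAt_convolution_right _ hfi (hρ.of_le (by simp)) x).fderiv,
    convolution_precompR_apply _ hfi (hρs.fderiv ℝ) (hρ.continuous_fderiv (by simp))]
  -- The weak gradient is tested with the reflected kernel; the sign from differentiating `x - t`
  -- cancels the one in the integration by parts.
  have hψ : ContDiff ℝ ∞ fun t => ρ (x - t) := hρ.comp (contDiff_const.sub contDiff_id)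
  have hψs : HasCompactSupport fun t => ρ (x - t) := hρs.comp_homeomorph (Homeomorph.subLeft x)
  have hd : ∀ t, fderiv ℝ (fun t => ρ (x - t)) t e = - fderiv ℝ ρ (x - t) e := by
    intro t
    have h1 : HasFDerivAt (fun t => x - t) (-(ContinuousLinearMap.id ℝ _)) t := by
      simpa using (hasFDerivAt_id t).const_sub x
    have h2 := ((hρ.differentiable (by simp)) (x - t)).hasFDerivAt.comp t h1
    have h3 := h2.fderiv
    simp only [Function.comp_def] at h3
    rw [h3]
    simp
  have hint := hf.integral_eq _ hψ hψs e
  simp only [hd, mul_neg, integral_neg, neg_inj] at hint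
  rw [convolution_lsmul_swap, convolution_def]
  simp only [ContinuousLinearMap.flip_apply, ContinuousLinearMap.lsmul_apply, smul_eq_mul]
  have hI : Integrable fun t => ρ (x - t) • Df t := by
    refine (hDi.integrable_smul_left_of_hasCompactSupport ?_ hψs)
    exact hψ.continuous
  rw [real_inner_comm, ← integral_inner hI]
  simp only [real_inner_comm _ e, inner_smul_left, conj_trivial]
  simp only [mul_comm] at hint ⊢
  exact hint

/-- Mollification: approximation by smooth functions supported near the support of `f`. -/
theorem IsCompactSobolev.exists_approx {N : ℕ} {f : EuclideanSpace ℝ (Fin N) → ℝ}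
    {Df : EuclideanSpace ℝ (Fin N) → EuclideanSpace ℝ (Fin N)} (hf : IsCompactSobolev f Df)
    {δ : ℝ} (hδ : 0 < δ) :
    ∃ ψ : ℕ → EuclideanSpace ℝ (Fin N) → ℝ, (∀ n, ContDiff ℝ ∞ (ψ n)) ∧
      (∀ n, tsupport (ψ n) ⊆ Metric.cthickening δ (tsupport f)) ∧
      TendstoUniformly ψ f atTop ∧
      Tendsto (fun n => eLpNorm (fun x => gradient (ψ n) x - Df x) 2 volume) atTop (𝓝 0) := by
  let r : ℕ → ℝ := fun n => δ / (n + 1)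
  have hr : ∀ n, 0 < r n := fun n => by positivity
  have hrδ : ∀ n, r n ≤ δ := fun n => div_le_self hδ.le (by simp)
  have hr0 : Tendsto r atTop (𝓝 0) := by
    have := (tendsto_one_div_add_atTop_nhds_zero_nat (𝕜 := ℝ)).const_mul δ
    simpa [r, div_eq_mul_inv] using this
  -- The radii tend to zero and never exceed `δ`, so every mollification stays supported in the same
  -- `δ`-thickening.
  let φ : ℕ → ContDiffBump (0 : EuclideanSpace ℝ (Fin N)) := fun n =>
    ⟨r n / 2, r n, half_pos (hr n), half_lt_self (hr n)⟩
  have hcd : ∀ n, ContDiff ℝ ∞ ((φ n).normed volume) := fun n => (φ n).contDiff_normed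
  have hcs : ∀ n, HasCompactSupport ((φ n).normed volume) := fun n => (φ n).hasCompactSupport_normed
  refine ⟨fun n => (φ n).normed volume ⋆[ContinuousLinearMap.lsmul ℝ ℝ] f, fun n => ?_, fun n => ?_,
    ?_, ?_⟩
  · exact (hcs n).contDiff_convolution_left _ (hcd n) hf.continuous.locallyIntegrable
  · refine closure_minimal ((support_convolution_subset _).trans ?_) Metric.isClosed_cthickening
    rw [(φ n).support_normed_eq]
    rintro _ ⟨a, ha, b, hb, rfl⟩
    refine Metric.mem_cthickening_of_dist_le _ b _ _ (subset_tsupport _ hb) ?_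
    have : dist a 0 < r n := ha
    rw [dist_zero_right] at this
    simp only [dist_eq_norm, add_sub_cancel_right]
    exact this.le.trans (hrδ n)
  · have huc : UniformContinuous f :=
      hf.hasCompactSupport.uniformContinuous_of_continuous hf.continuous
    rw [Metric.tendstoUniformly_iff]
    intro ε hε
    obtain ⟨d, hd, h⟩ := Metric.uniformContinuous_iff.1 huc (ε / 2) (half_pos hε)
    filter_upwards [hr0.eventually (gt_mem_nhds hd)] with n hn x
    rw [dist_comm]
    refine lt_of_le_of_lt (ContDiffBump.dist_normed_convolution_le
      hf.continuous.aestronglyMeasurable fun y hy => ?_) (half_lt_self hε)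
    exact (h (lt_trans (Metric.mem_ball.1 hy) hn)).le
  · simp_rw [gradient_convolution hf (hcd _) (hcs _)]
    have ht := tendsto_eLpNorm_translate_sub volume hf.memLp_grad
    rw [ENNReal.tendsto_nhds_zero] at ht ⊢
    intro ε hε
    obtain ⟨d, hd, h⟩ := Metric.eventually_nhds_iff.1 (ht ε hε)
    filter_upwards [hr0.eventually (gt_mem_nhds hd)] with n hn
    refine eLpNorm_convolution_sub_le volume hf.memLp_grad (hcd n).continuous (hcs n)
      (φ n).nonneg_normed (φ n).integral_normed fun y hy => h ?_
    rw [(φ n).support_normed_eq] at hy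
    exact lt_trans hy hn

/-! ### Chain rule. -/

/-- Split `aₙ Yₙ = aₙ (Yₙ - Y₀) + aₙ Y₀`. Uniform convergence to a bounded limit bounds `aₙ`
eventually by `C + 1`, so the first part vanishes in `L¹` and the second converges by domination. -/
theorem tendsto_integral_smul_of_tendstoUniformly {α F : Type*} [MeasurableSpace α]
    {μ : Measure α} [NormedAddCommGroup F] [NormedSpace ℝ F] {a : ℕ → α → ℝ} {a₀ : α → ℝ}
    {Y : ℕ → α → F} {Y₀ : α → F} (ha : TendstoUniformly a a₀ atTop)
    (ham : ∀ n, AEStronglyMeasurable (a n) μ) {C : ℝ} (hC : ∀ x, |a₀ x| ≤ C)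
    (hY : ∀ n, Integrable (Y n) μ) (hY₀ : Integrable Y₀ μ)
    (h : Tendsto (fun n => eLpNorm (fun x => Y n x - Y₀ x) 1 μ) atTop (𝓝 0)) :
    Tendsto (fun n => ∫ x, a n x • Y n x ∂μ) atTop (𝓝 (∫ x, a₀ x • Y₀ x ∂μ)) := by
  have hb : ∀ᶠ n in atTop, ∀ x, ‖a n x‖ ≤ C + 1 := by
    filter_upwards [Metric.tendstoUniformly_iff.1 ha 1 one_pos] with n hn x
    have h1 := (hn x).le
    rw [dist_comm, Real.dist_eq] at h1
    rw [Real.norm_eq_abs]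
    have := abs_sub_abs_le_abs_sub (a n x) (a₀ x)
    linarith [hC x]
  have h2 : Tendsto (fun n => ∫ x, a n x • Y₀ x ∂μ) atTop (𝓝 (∫ x, a₀ x • Y₀ x ∂μ)) := by
    refine tendsto_integral_filter_of_dominated_convergence (fun x => (C + 1) * ‖Y₀ x‖)
      (Eventually.of_forall fun n => (ham n).smul hY₀.1) ?_ (hY₀.norm.const_mul _) ?_
    · filter_upwards [hb] with n hn
      refine ae_of_all _ fun x => ?_
      rw [norm_smul]
      exact mul_le_mul_of_nonneg_right (hn x) (norm_nonneg _)
    · exact ae_of_all _ fun x => (ha.tendsto_at x).smul_const _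
  have h3 : Tendsto (fun n => ∫ x, a n x • (Y n x - Y₀ x) ∂μ) atTop (𝓝 0) := by
    have h4 : Tendsto (fun n => (C + 1) * (eLpNorm (fun x => Y n x - Y₀ x) 1 μ).toReal) atTop
        (𝓝 0) := by
      simpa using ((ENNReal.tendsto_toReal ENNReal.zero_ne_top).comp h).const_mul (C + 1)
    refine squeeze_zero_norm' ?_ h4
    filter_upwards [hb] with n hn
    have hi : Integrable (fun x => Y n x - Y₀ x) μ := (hY n).sub hY₀
    have : (eLpNorm (fun x => Y n x - Y₀ x) 1 μ).toReal = ∫ x, ‖Y n x - Y₀ x‖ ∂μ := by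
      rw [eLpNorm_one_eq_lintegral_enorm, integral_norm_eq_lintegral_enorm hi.1]
    rw [this, ← integral_const_mul]
    refine norm_integral_le_of_norm_le (hi.norm.const_mul _) (ae_of_all _ fun x => ?_)
    rw [norm_smul]
    exact mul_le_mul_of_nonneg_right (hn x) (norm_nonneg _)
  have h5 := h3.add h2
  rw [zero_add] at h5
  refine h5.congr' ?_
  filter_upwards [hb] with n hn
  have hia : ∀ {Z : α → F}, Integrable Z μ → Integrable (fun x => a n x • Z x) μ := fun hZ =>
    hZ.bdd_smul (C + 1) (ham n) (ae_of_all _ hn)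
  have hs : Integrable (fun x => a n x • (Y n x - Y₀ x)) μ := hia ((hY n).sub hY₀)
  rw [← integral_add hs (hia hY₀)]
  simp only [smul_sub, sub_add_cancel]

theorem eLpNorm_one_smul_le {α F : Type*} [MeasurableSpace α] {μ : Measure α}
    [NormedAddCommGroup F] [NormedSpace ℝ F] {ψ : α → ℝ} {X : α → F}
    (hψ : AEStronglyMeasurable ψ μ) (hX : AEStronglyMeasurable X μ) :
    eLpNorm (fun x => ψ x • X x) 1 μ ≤ eLpNorm ψ 2 μ * eLpNorm X 2 μ :=
  eLpNorm_smul_le_mul_eLpNorm hX hψ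

/-- The smooth case of the chain rule. The gradient side is kept as one vector integral so that the
limit in `IsCompactSobolev.comp` can be taken before pairing with `e`. -/
theorem integral_comp_mul_fderiv {N : ℕ} {η ψ : EuclideanSpace ℝ (Fin N) → ℝ} {G : ℝ → ℝ}
    (hη : ContDiff ℝ 1 η) (hηs : HasCompactSupport η) (hψ : ContDiff ℝ 1 ψ)
    (hψs : HasCompactSupport ψ) (hG : ContDiff ℝ 1 G) (hG0 : G 0 = 0)
    (e : EuclideanSpace ℝ (Fin N)) :
    ∫ x, G (η x) * fderiv ℝ ψ x e
      = - inner ℝ (∫ x, deriv G (η x) • ψ x • gradient η x) e := by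
  have hdG : ∀ x, fderiv ℝ (fun x => G (η x)) x e
      = deriv G (η x) * inner ℝ (gradient η x) e := by
    intro x
    have h1 := ((hG.differentiable (by simp)) (η x)).hasDerivAt.comp_hasFDerivAt x
      ((hη.differentiable (by simp)) x).hasFDerivAt
    have h2 := h1.fderiv
    simp only [Function.comp_def] at h2
    rw [h2, inner_gradient_left]
    simp
  have hgrad : Continuous (gradient η) :=
    (InnerProductSpace.toDual ℝ _).symm.continuous.comp (hη.continuous_fderiv (by simp))
  have hGs : HasCompactSupport fun x => G (η x) := hηs.comp_left hG0
  have hGcd : ContDiff ℝ 1 fun x => G (η x) := hG.comp hη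
  have hI : Integrable fun x => (deriv G (η x) * ψ x) • gradient η x := by
    refine Continuous.integrable_of_hasCompactSupport ?_ (hψs.mul_left.smul_right)
    exact (((hG.continuous_deriv (by simp)).comp hη.continuous).mul hψ.continuous).smul hgrad
  have hψ' : Continuous fun x => fderiv ℝ ψ x e :=
    (hψ.continuous_fderiv (by simp)).clm_apply continuous_const
  rw [integral_mul_fderiv_eq_neg_fderiv_mul_of_integrable (μ := volume)
    (f := fun x => G (η x)) (g := ψ) (v := e) ?_ ?_ ?_
    (fun x _ => (hGcd.differentiable (by simp)) x) (fun x _ => (hψ.differentiable (by simp)) x)]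
  · rw [neg_inj, real_inner_comm]
    simp_rw [smul_smul]
    rw [← integral_inner hI]
    refine integral_congr_ae (ae_of_all _ fun x => ?_)
    simp only [hdG, inner_smul_right, real_inner_comm e]
    ring
  · refine Continuous.integrable_of_hasCompactSupport ?_ hψs.mul_left
    exact ((hGcd.continuous_fderiv (by simp)).clm_apply continuous_const).mul hψ.continuous
  · exact (hGcd.continuous.mul hψ').integrable_of_hasCompactSupport hGs.mul_right
  · exact (hGcd.continuous.mul hψ.continuous).integrable_of_hasCompactSupport hψs.mul_left

namespace IsCompactSobolev

variable {N : ℕ} {f : EuclideanSpace ℝ (Fin N) → ℝ}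
  {Df : EuclideanSpace ℝ (Fin N) → EuclideanSpace ℝ (Fin N)}

theorem exists_abs_le (hf : IsCompactSobolev f Df) : ∃ C, ∀ x, |f x| ≤ C :=
  hf.hasCompactSupport.exists_bound_of_continuous hf.continuous

theorem exists_abs_comp_le (hf : IsCompactSobolev f Df) {G : ℝ → ℝ} (hG : Continuous G) :
    ∃ C, ∀ x, |G (f x)| ≤ C := by
  obtain ⟨R, hR⟩ := hf.exists_abs_le
  obtain ⟨C, hC⟩ := (isCompact_Icc (a := -R) (b := R)).exists_bound_of_continuousOn hG.continuousOn
  exact ⟨C, fun x => hC _ (abs_le.1 (hR x))⟩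

/-- Eventually all values lie in a fixed compact interval, on which `G` is uniformly continuous. -/
theorem tendstoUniformly_comp (hf : IsCompactSobolev f Df)
    {ψ : ℕ → EuclideanSpace ℝ (Fin N) → ℝ} (hψ : TendstoUniformly ψ f atTop) {G : ℝ → ℝ}
    (hG : Continuous G) :
    TendstoUniformly (fun n x => G (ψ n x)) (fun x => G (f x)) atTop := by
  obtain ⟨R, hR⟩ := hf.exists_abs_le
  have huc : UniformContinuousOn G (Set.Icc (-(R + 1)) (R + 1)) :=
    isCompact_Icc.uniformContinuousOn_of_continuous hG.continuousOn
  refine UniformContinuousOn.comp_tendstoUniformly_eventually (s := Set.Icc (-(R + 1)) (R + 1)) ?_ ?_ huc hψ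
  · filter_upwards [Metric.tendstoUniformly_iff.1 hψ 1 one_pos] with n hn x
    have h1 := (hn x).le
    rw [dist_comm, Real.dist_eq] at h1
    have := abs_sub_abs_le_abs_sub (ψ n x) (f x)
    exact abs_le.1 (by linarith [hR x])
  · intro x
    exact abs_le.1 (by linarith [hR x])

/-- Chain rule for the composition with a `C¹` function. -/
theorem comp (hf : IsCompactSobolev f Df) {G : ℝ → ℝ} (hG : ContDiff ℝ 1 G) (hG0 : G 0 = 0) :
    IsCompactSobolev (fun x => G (f x)) (fun x => deriv G (f x) • Df x) := by
  have hG' : Continuous (deriv G) := hG.continuous_deriv (by simp)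
  obtain ⟨C, hC⟩ := hf.exists_abs_comp_le hG.continuous
  obtain ⟨C', hC'⟩ := hf.exists_abs_comp_le hG'
  refine ⟨hG.continuous.comp hf.continuous, hf.hasCompactSupport.comp_left hG0, ?_, ?_⟩
  · refine hf.memLp_grad.of_le_mul (c := C')
      ((hG'.comp hf.continuous).aestronglyMeasurable.smul hf.memLp_grad.1) (ae_of_all _ fun x => ?_)
    rw [norm_smul]
    exact mul_le_mul_of_nonneg_right (hC' x) (norm_nonneg _)
  · intro ψ hψ hψs e
    -- Both sides of the classical identity for `η n` pass to the limit: `G` and `deriv G` of `η n`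
    -- converge uniformly, the gradients in `L²`. The radius `1` is arbitrary; it only ensures
    -- compact supports.
    obtain ⟨η, hη, hηs, hηu, hηg⟩ := hf.exists_approx one_pos
    have hηc : ∀ n, HasCompactSupport (η n) := fun n =>
      hf.hasCompactSupport.isCompact.cthickening.of_isClosed_subset (isClosed_tsupport _) (hηs n)
    have hgrad : ∀ n, Continuous (gradient (η n)) := fun n =>
      (InnerProductSpace.toDual ℝ _).symm.continuous.comp ((hη n).continuous_fderiv (by simp))
    have hgs : ∀ n, HasCompactSupport (gradient (η n)) := fun n =>
      ((hηc n).fderiv ℝ).comp_left (map_zero (InnerProductSpace.toDual ℝ _).symm)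
    have hg2 : ∀ n, MemLp (gradient (η n)) 2 volume := fun n =>
      (hgrad n).memLp_of_hasCompactSupport (hgs n)
    have hψ2 : MemLp ψ 2 volume := hψ.continuous.memLp_of_hasCompactSupport hψs
    have hY₀ : Integrable fun x => ψ x • Df x := memLp_one_iff_integrable.1 (hf.memLp_grad.smul hψ2)
    have hY : ∀ n, Integrable fun x => ψ x • gradient (η n) x := fun n =>
      memLp_one_iff_integrable.1 ((hg2 n).smul hψ2)
    have hlim : Tendsto (fun n => eLpNorm (fun x => ψ x • gradient (η n) x - ψ x • Df x) 1 volume)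
        atTop (𝓝 0) := by
      have h1 : Tendsto (fun n => eLpNorm ψ 2 volume *
          eLpNorm (fun x => gradient (η n) x - Df x) 2 volume) atTop (𝓝 0) := by
        simpa using ENNReal.Tendsto.const_mul hηg (Or.inr hψ2.2.ne)
      refine tendsto_of_tendsto_of_tendsto_of_le_of_le tendsto_const_nhds h1 (fun _ => zero_le)
        fun n => ?_
      simp only [← smul_sub]
      exact eLpNorm_one_smul_le hψ2.1 ((hg2 n).1.sub hf.memLp_grad.1)
    have hcompG : ∀ n, Continuous fun x => deriv G (η n x) := fun n =>
      hG'.comp (hη n).continuous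
    have hR := tendsto_integral_smul_of_tendstoUniformly (hf.tendstoUniformly_comp hηu hG')
      (fun n => (hcompG n).aestronglyMeasurable) hC' hY hY₀ hlim
    have hdi : Integrable fun x => fderiv ℝ ψ x e :=
      ((hψ.continuous_fderiv (by simp)).clm_apply continuous_const).integrable_of_hasCompactSupport
        (hψs.fderiv_apply ℝ e)
    have hL := tendsto_integral_smul_of_tendstoUniformly (Y := fun _ x => fderiv ℝ ψ x e)
      (hf.tendstoUniformly_comp hηu hG.continuous) (μ := volume)
      (fun n => (hG.continuous.comp (hη n).continuous).aestronglyMeasurable) hC (fun _ => hdi) hdi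
      (by simp)
    have hR' := (hR.inner (𝕜 := ℝ) (tendsto_const_nhds (x := e))).neg
    have heq : ∀ n, ∫ x, G (η n x) • fderiv ℝ ψ x e
        = - inner ℝ (∫ x, deriv G (η n x) • ψ x • gradient (η n) x) e := fun n =>
      integral_comp_mul_fderiv ((hη n).of_le (by simp)) (hηc n) (hψ.of_le (by simp)) hψs hG hG0 e
    have hfin := tendsto_nhds_unique (hL.congr heq) hR'
    simp only [smul_eq_mul] at hfin
    have hI : Integrable fun x => deriv G (f x) • ψ x • Df x :=
      hY₀.bdd_smul C' (hG'.comp hf.continuous).aestronglyMeasurable (ae_of_all _ hC')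
    rw [hfin, neg_inj, real_inner_comm, ← integral_inner hI]
    refine integral_congr_ae (ae_of_all _ fun x => ?_)
    simp only [inner_smul_right, real_inner_comm e]
    ring

end IsCompactSobolev

/-! ### Level sets, Sobolev's inequality and admissibility. -/

namespace IsCompactSobolev

variable {N : ℕ} {f : EuclideanSpace ℝ (Fin N) → ℝ}
  {Df : EuclideanSpace ℝ (Fin N) → EuclideanSpace ℝ (Fin N)}

/-- The weak gradient vanishes almost everywhere on level sets. -/
theorem grad_eq_zero_of_level (hf : IsCompactSobolev f Df) (c : ℝ) :
    ∀ᵐ x, f x = c → Df x = 0 := by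
  classical
  let A : Set (EuclideanSpace ℝ (Fin N)) := {x | f x = c}
  have hA : MeasurableSet A := (isClosed_singleton.preimage hf.continuous).measurableSet
  have hDi : LocallyIntegrable Df := hf.memLp_grad.locallyIntegrable (by norm_num)
  suffices h : ∀ᵐ x, A.indicator Df x = 0 by
    filter_upwards [h] with x hx hxc
    rwa [Set.indicator_of_mem (show x ∈ A from hxc)] at hx
  refine ae_eq_zero_of_integral_contDiff_smul_eq_zero (hDi.indicator hA) fun ψ hψ hψs => ?_
  have hY : Integrable fun x => ψ x • Df x :=
    memLp_one_iff_integrable.1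
      (hf.memLp_grad.smul (hψ.continuous.memLp_of_hasCompactSupport (p := 2) hψs))
  -- These functions tend to zero uniformly, while their derivatives stay in `[0, 1]` and converge
  -- pointwise to the indicator of `{c}`. The subtracted constant gives `G n 0 = 0`, as the chain
  -- rule requires.
  let G : ℕ → ℝ → ℝ := fun n t =>
    (Real.arctan ((n + 1) * (t - c)) - Real.arctan ((n + 1) * (0 - c))) / (n + 1)
  have hGd : ∀ n t, HasDerivAt (G n) (1 / (1 + ((n + 1) * (t - c)) ^ 2)) t := by
    intro n t
    have h1 : HasDerivAt (fun t : ℝ => ((n : ℝ) + 1) * (t - c)) (((n : ℝ) + 1) * 1) t :=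
      ((hasDerivAt_id t).sub_const c).const_mul _
    have h2 := ((h1.arctan).sub_const (Real.arctan ((n + 1) * (0 - c)))).div_const ((n : ℝ) + 1)
    rw [mul_one, mul_div_cancel_right₀ _ (by positivity)] at h2
    exact h2
  have hGc : ∀ n, ContDiff ℝ 1 (G n) := by
    intro n
    exact ((Real.contDiff_arctan.comp (by fun_prop)).sub contDiff_const).div_const _
  have hGb : ∀ n t, |G n t| ≤ Real.pi / (n + 1) := by
    intro n t
    have hn : (0 : ℝ) < n + 1 := by positivity
    simp only [G]
    rw [abs_div, abs_of_pos hn]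
    gcongr
    have h1 := Real.arctan_lt_pi_div_two ((n + 1) * (t - c))
    have h2 := Real.neg_pi_div_two_lt_arctan ((n + 1) * (t - c))
    have h3 := Real.arctan_lt_pi_div_two ((n + 1) * (0 - c))
    have h4 := Real.neg_pi_div_two_lt_arctan ((n + 1) * (0 - c))
    rw [abs_le]
    constructor <;> linarith
  have hpi : Tendsto (fun n : ℕ => Real.pi / ((n : ℝ) + 1)) atTop (𝓝 0) := by
    have := (tendsto_one_div_add_atTop_nhds_zero_nat (𝕜 := ℝ)).const_mul Real.pi
    simpa [div_eq_mul_inv] using this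
  have hlim : Tendsto (fun n => ∫ x, deriv (G n) (f x) • ψ x • Df x) atTop
      (𝓝 (∫ x, ψ x • A.indicator Df x)) := by
    refine tendsto_integral_of_dominated_convergence (fun x => ‖ψ x • Df x‖) (fun n => ?_) hY.norm
      (fun n => ae_of_all _ fun x => ?_) (ae_of_all _ fun x => ?_)
    · exact ((((hGc n).continuous_deriv (by simp)).comp hf.continuous).aestronglyMeasurable).smul hY.1
    · rw [norm_smul, (hGd n _).deriv]
      refine mul_le_of_le_one_left (norm_nonneg _) ?_
      rw [Real.norm_of_nonneg (by positivity)]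
      exact div_le_one_of_le₀ (by nlinarith [sq_nonneg (((n : ℝ) + 1) * (f x - c))]) (by positivity)
    · by_cases hx : x ∈ A
      · rw [Set.indicator_of_mem hx]
        have : ∀ n, deriv (G n) (f x) • ψ x • Df x = ψ x • Df x := by
          intro n
          rw [(hGd n _).deriv, show f x = c from hx]
          simp
        simp [this]
      · rw [Set.indicator_of_notMem hx, smul_zero]
        have hne : 0 < (f x - c) ^ 2 := by
          have : f x - c ≠ 0 := sub_ne_zero.2 hx
          positivity
        have h0 : Tendsto (fun n : ℕ => deriv (G n) (f x)) atTop (𝓝 0) := by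
          simp_rw [(hGd _ _).deriv]
          have h1 : Tendsto (fun n : ℕ => (1 / ((n : ℝ) + 1)) * (1 / (f x - c) ^ 2)) atTop (𝓝 0) := by
            rw [← zero_mul (1 / (f x - c) ^ 2)]
            exact (tendsto_one_div_add_atTop_nhds_zero_nat (𝕜 := ℝ)).mul_const _
          refine squeeze_zero (fun n => by positivity) (fun n => ?_) h1
          rw [one_div_mul_one_div]
          refine one_div_le_one_div_of_le (by positivity) ?_
          have hn : (0 : ℝ) ≤ n := by positivity
          nlinarith [mul_nonneg hn hne.le, mul_nonneg (mul_nonneg hn hn) hne.le]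
        simpa using h0.smul_const (ψ x • Df x)
  -- The same integrals tend to zero: moving the derivative onto `ψ` leaves `G n (f x)`, which is at
  -- most `π / (n + 1)` in absolute value.
  refine ext_inner_right ℝ fun e => ?_
  rw [inner_zero_left]
  refine tendsto_nhds_unique (hlim.inner (𝕜 := ℝ) (tendsto_const_nhds (x := e))) ?_
  have hd : Continuous fun x => fderiv ℝ ψ x e :=
    (hψ.continuous_fderiv (by simp)).clm_apply continuous_const
  have hdi : Integrable fun x => fderiv ℝ ψ x e :=
    hd.integrable_of_hasCompactSupport (hψs.fderiv_apply ℝ e)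
  have hle : Tendsto (fun n : ℕ => Real.pi / ((n : ℝ) + 1) * ∫ x, ‖fderiv ℝ ψ x e‖) atTop (𝓝 0) := by
    simpa using hpi.mul_const (∫ x, ‖fderiv ℝ ψ x e‖)
  refine squeeze_zero_norm (fun n => ?_) hle
  have hG0 : G n 0 = 0 := by simp [G]
  have hw := (hf.comp (hGc n) hG0).integral_eq ψ hψ hψs e
  have hI : Integrable fun x => deriv (G n) (f x) • ψ x • Df x := by
    refine hY.bdd_smul 1 (((hGc n).continuous_deriv (by simp)).comp hf.continuous).aestronglyMeasurable
      (ae_of_all _ fun x => ?_)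
    rw [Function.comp_apply, (hGd n _).deriv, Real.norm_of_nonneg (by positivity)]
    exact div_le_one_of_le₀ (by nlinarith [sq_nonneg (((n : ℝ) + 1) * (f x - c))]) (by positivity)
  have heq : inner ℝ (∫ x, deriv (G n) (f x) • ψ x • Df x) e
      = - ∫ x, G n (f x) * fderiv ℝ ψ x e := by
    rw [hw, neg_neg, real_inner_comm, ← integral_inner hI]
    refine integral_congr_ae (ae_of_all _ fun x => ?_)
    simp only [inner_smul_right, real_inner_comm e]
    ring
  rw [heq, norm_neg, ← integral_const_mul]
  refine norm_integral_le_of_norm_le (hdi.norm.const_mul _) (ae_of_all _ fun x => ?_)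
  rw [norm_mul]
  exact mul_le_mul_of_nonneg_right (hGb n _) (norm_nonneg _)

/-- Sobolev's inequality. -/
theorem exists_eLpNorm_le (hN : 0 < N) {p : NNReal} (hp : (p : ℝ)⁻¹ = 2⁻¹ - (N : ℝ)⁻¹) :
    ∃ C : NNReal, ∀ (f : EuclideanSpace ℝ (Fin N) → ℝ)
      (Df : EuclideanSpace ℝ (Fin N) → EuclideanSpace ℝ (Fin N)), IsCompactSobolev f Df →
      eLpNorm f p volume ≤ C * eLpNorm Df 2 volume := by
  refine ⟨SNormLESNormFDerivOfEqConst ℝ (volume : Measure (EuclideanSpace ℝ (Fin N))) (2 : NNReal),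
    fun f Df hf => ?_⟩
  set C := SNormLESNormFDerivOfEqConst ℝ (volume : Measure (EuclideanSpace ℝ (Fin N))) (2 : NNReal)
  obtain ⟨η, hη, hηs, hηu, hηg⟩ := hf.exists_approx one_pos
  have hηc : ∀ n, HasCompactSupport (η n) := fun n =>
    hf.hasCompactSupport.isCompact.cthickening.of_isClosed_subset (isClosed_tsupport _) (hηs n)
  have hgrad : ∀ n, Continuous (gradient (η n)) := fun n =>
    (InnerProductSpace.toDual ℝ _).symm.continuous.comp ((hη n).continuous_fderiv (by simp))
  have h1 : ∀ n, eLpNorm (η n) p volume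
      ≤ C * (eLpNorm (fun x => gradient (η n) x - Df x) 2 volume + eLpNorm Df 2 volume) := by
    intro n
    have h2 := eLpNorm_le_eLpNorm_fderiv_of_eq volume ((hη n).of_le (by simp) : ContDiff ℝ 1 (η n))
      (hηc n) (p := 2) (p' := p) (by norm_num) (by simpa using hN) (by simpa using hp)
    refine h2.trans ?_
    gcongr
    have h3 : eLpNorm (fderiv ℝ (η n)) (2 : NNReal) volume = eLpNorm (gradient (η n)) 2 volume := by
      refine eLpNorm_congr_norm_ae (ae_of_all _ fun x => ?_)
      simp [gradient]
    rw [h3]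
    have h4 := eLpNorm_add_le (p := 2) ((hgrad n).aestronglyMeasurable.sub hf.memLp_grad.1)
      hf.memLp_grad.1 (by norm_num)
    rw [sub_add_cancel] at h4
    exact h4
  -- Fatou's lemma: pointwise convergence is enough on the left side, so no convergence in `L^p` is
  -- needed.
  have h5 := Lp.eLpNorm_lim_le_liminf_eLpNorm (p := (p : ℝ≥0∞)) (μ := volume)
    (fun n => (hη n).continuous.aestronglyMeasurable) f (ae_of_all _ fun x => hηu.tendsto_at x)
  refine h5.trans ((liminf_le_liminf (Eventually.of_forall h1)).trans ?_)
  have h6 : Tendsto (fun n => (C : ℝ≥0∞) * (eLpNorm (fun x => gradient (η n) x - Df x) 2 volume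
      + eLpNorm Df 2 volume)) atTop (𝓝 (C * (0 + eLpNorm Df 2 volume))) :=
    ENNReal.Tendsto.const_mul (hηg.add tendsto_const_nhds) (Or.inr ENNReal.coe_ne_top)
  rw [h6.liminf_eq, zero_add]

/-- Mollifying at a scale for which the thickened support stays in `Ω` gives functions in
`C_c^∞(Ω)`. Their uniform convergence on one compact set of finite measure gives `L²` convergence.
-/
theorem isAdmissible (hf : IsCompactSobolev f Df) (h0 : ∀ x, 0 ≤ f x)
    {Ω : Set (EuclideanSpace ℝ (Fin N))} (hΩ : IsOpen Ω) (hs : tsupport f ⊆ Ω) :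
    IsAdmissible Ω f Df := by
  obtain ⟨δ, hδ, hδΩ⟩ := hf.hasCompactSupport.isCompact.exists_cthickening_subset_open hΩ hs
  obtain ⟨η, hη, hηs, hηu, hηg⟩ := hf.exists_approx hδ
  set K := Metric.cthickening δ (tsupport f) with hK
  have hKc : IsCompact K := hf.hasCompactSupport.isCompact.cthickening
  have hηc : ∀ n, HasCompactSupport (η n) := fun n =>
    hKc.of_isClosed_subset (isClosed_tsupport _) (hηs n)
  have hf2 : MemLp f 2 volume := hf.continuous.memLp_of_hasCompactSupport hf.hasCompactSupport
  obtain ⟨C, hC⟩ := hf.exists_abs_le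
  refine ⟨⟨hf2.restrict _, hf.memLp_grad.restrict _, ⟨hf.continuous.locallyIntegrable.locallyIntegrableOn _,
    (hf.memLp_grad.locallyIntegrable (by norm_num)).locallyIntegrableOn _, fun ψ hψ e => ?_⟩, η,
    fun n => ⟨hη n, hηc n, (hηs n).trans hδΩ⟩, ?_, ?_⟩, ?_, ae_of_all _ h0, tsupport f,
    hf.hasCompactSupport, hs, ae_of_all _ fun x hx => image_eq_zero_of_notMem_tsupport hx⟩
  · rw [setIntegral_eq_integral_of_forall_compl_eq_zero, setIntegral_eq_integral_of_forall_compl_eq_zero]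
    · exact hf.integral_eq ψ hψ.smooth hψ.compact_support e
    · intro x hx
      rw [image_eq_zero_of_notMem_tsupport fun h => hx (hψ.support_subset h), mul_zero]
    · intro x hx
      have : fderiv ℝ ψ x = 0 :=
        image_eq_zero_of_notMem_tsupport fun h => hx (hψ.support_subset (tsupport_fderiv_subset ℝ h))
      simp [this]
  · have hKf : volume K ≠ ⊤ := hKc.measure_lt_top.ne
    have h1 : Tendsto (fun n => volume K ^ (2 : ℝ)⁻¹ * ENNReal.ofReal (⨆ x, |η n x - f x|)) atTop (𝓝 0) := by
      have h2 : Tendsto (fun n => ⨆ x, |η n x - f x|) atTop (𝓝 0) := by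
        rw [Metric.tendsto_atTop]
        intro ε hε
        obtain ⟨n₀, h⟩ := eventually_atTop.1 (Metric.tendstoUniformly_iff.1 hηu (ε / 2) (half_pos hε))
        refine ⟨n₀, fun n hn => ?_⟩
        rw [Real.dist_0_eq_abs, abs_of_nonneg (Real.iSup_nonneg fun _ => abs_nonneg _)]
        refine lt_of_le_of_lt (Real.iSup_le (fun x => ?_) (half_pos hε).le) (half_lt_self hε)
        have := (h n hn x).le
        rwa [dist_comm, Real.dist_eq] at this
      have h3 := ENNReal.Tendsto.const_mul (ENNReal.tendsto_ofReal h2)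
        (Or.inr (ENNReal.rpow_ne_top_of_nonneg (y := (2 : ℝ)⁻¹) (by norm_num) hKf))
      simpa using h3
    refine tendsto_of_tendsto_of_tendsto_of_le_of_le tendsto_const_nhds h1 (fun _ => zero_le) fun n => ?_
    have hsupp : Function.support (fun x => η n x - f x) ⊆ K := by
      intro x hx
      by_contra hxK
      refine hx ?_
      simp only
      rw [image_eq_zero_of_notMem_tsupport fun h => hxK (hηs n h),
        image_eq_zero_of_notMem_tsupport fun h => hxK (Metric.self_subset_cthickening _ h), sub_zero]
    have hbdd : BddAbove (Set.range fun x => |η n x - f x|) := by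
      obtain ⟨C', hC'⟩ := ((hηc n).sub hf.hasCompactSupport).exists_bound_of_continuous
        ((hη n).continuous.sub hf.continuous)
      exact ⟨C', by rintro _ ⟨x, rfl⟩; exact hC' x⟩
    refine (eLpNorm_mono_measure _ Measure.restrict_le_self).trans ?_
    rw [← eLpNorm_restrict_eq_of_support_subset hsupp]
    refine (eLpNorm_le_of_ae_bound (C := ⨆ x, |η n x - f x|) (ae_of_all _ fun x => le_ciSup hbdd x)).trans ?_
    simp
  · exact tendsto_of_tendsto_of_tendsto_of_le_of_le tendsto_const_nhds hηg (fun _ => zero_le)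
      fun n => eLpNorm_mono_measure _ Measure.restrict_le_self
  · exact memLp_top_of_bound hf.continuous.aestronglyMeasurable C (ae_of_all _ hC)

end IsCompactSobolev

/-! ### Truncated powers, localization and Hölder's inequality. -/

/-- The positive part itself is not `C¹`, but every power from the square on is; with such powers
the `C¹` chain rule suffices for all truncations. -/
theorem hasDerivAt_max_sub_pow (k : ℝ) (n : ℕ) (t : ℝ) :
    HasDerivAt (fun t : ℝ => max (t - k) 0 ^ (n + 2)) ((n + 2) * max (t - k) 0 ^ (n + 1)) t := by
  rcases lt_trichotomy t k with h | rfl | h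
  · have h0 : max (t - k) 0 = 0 := max_eq_right (by linarith)
    rw [h0]
    have : HasDerivAt (fun _ : ℝ => (0 : ℝ)) (((n : ℝ) + 2) * 0 ^ (n + 1)) t := by
      simpa using hasDerivAt_const t (0 : ℝ)
    refine this.congr_of_eventuallyEq ?_
    filter_upwards [Iio_mem_nhds h] with s hs
    rw [max_eq_right (by linarith [Set.mem_Iio.1 hs])]
    simp
  · have hO : (fun s : ℝ => max (s - t) 0 ^ (n + 2)) =O[𝓝 t] fun s => ‖s - t‖ ^ (n + 2) := by
      refine Asymptotics.IsBigO.of_bound 1 (Eventually.of_forall fun s => ?_)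
      rw [one_mul, norm_pow, norm_pow, norm_norm]
      refine pow_le_pow_left₀ (norm_nonneg _) ?_ _
      rw [Real.norm_of_nonneg (le_max_right _ _), Real.norm_eq_abs]
      exact max_le (le_abs_self _) (abs_nonneg _)
    have := (hO.hasFDerivAt (by omega)).hasDerivAt
    simpa using this
  · have h1 : HasDerivAt (fun s : ℝ => (s - k) ^ (n + 2)) ((n + 2) * (t - k) ^ (n + 1)) t := by
      simpa using ((hasDerivAt_id t).sub_const k).fun_pow (n + 2)
    rw [max_eq_left (by linarith)]
    refine h1.congr_of_eventuallyEq ?_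
    filter_upwards [Ioi_mem_nhds h] with s hs
    rw [max_eq_left (by linarith [Set.mem_Ioi.1 hs])]

theorem contDiff_max_sub_pow (k : ℝ) (n : ℕ) :
    ContDiff ℝ 1 (fun t : ℝ => max (t - k) 0 ^ (n + 2)) := by
  rw [contDiff_one_iff_deriv]
  refine ⟨fun t => (hasDerivAt_max_sub_pow k n t).differentiableAt, ?_⟩
  rw [show deriv (fun t : ℝ => max (t - k) 0 ^ (n + 2)) = _ from
    funext fun t => (hasDerivAt_max_sub_pow k n t).deriv]
  fun_prop

theorem integrable_inner_mul {N : ℕ}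
    {X : EuclideanSpace ℝ (Fin N) → EuclideanSpace ℝ (Fin N)}
    (hX : MemLp X 2 volume) {ψ : EuclideanSpace ℝ (Fin N) → ℝ} (hψ : Continuous ψ)
    (hψs : HasCompactSupport ψ) (e : EuclideanSpace ℝ (Fin N)) :
    Integrable fun x => inner ℝ (X x) e * ψ x := by
  have h1 : MemLp (fun x => inner ℝ (X x) e) 2 volume := hX.inner_const e
  exact memLp_one_iff_integrable.1 ((hψ.memLp_of_hasCompactSupport hψs (p := 2)).mul h1)

/-- Hölder's inequality for three factors. -/
theorem lintegral_mul_three_le {α : Type*} [MeasurableSpace α] {μ : Measure α} {a b c : α → ℝ}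
    (ha : AEStronglyMeasurable a μ) (hb : AEStronglyMeasurable b μ) (hc : AEStronglyMeasurable c μ)
    {p q r : ℝ≥0∞} (h : p⁻¹ + (q⁻¹ + r⁻¹) = 1) :
    ∫⁻ x, ‖a x * (b x * c x)‖ₑ ∂μ ≤ eLpNorm a p μ * (eLpNorm b q μ * eLpNorm c r μ) := by
  have i1 : ENNReal.HolderTriple q r (q⁻¹ + r⁻¹)⁻¹ := ⟨by simp⟩
  have i2 : ENNReal.HolderTriple p (q⁻¹ + r⁻¹)⁻¹ 1 := ⟨by simpa using h⟩
  rw [← eLpNorm_one_eq_lintegral_enorm]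
  refine (eLpNorm_smul_le_mul_eLpNorm (p := p) (q := (q⁻¹ + r⁻¹)⁻¹) (φ := a) (hb.mul hc) ha).trans ?_
  gcongr
  exact eLpNorm_smul_le_mul_eLpNorm (p := q) (q := r) (φ := b) hc hb

namespace IsCompactSobolev

variable {N : ℕ} {f : EuclideanSpace ℝ (Fin N) → ℝ}
  {Df : EuclideanSpace ℝ (Fin N) → EuclideanSpace ℝ (Fin N)}

theorem max_sub_pow (hf : IsCompactSobolev f Df) {k : ℝ} (hk : 0 ≤ k) (n : ℕ) :
    IsCompactSobolev (fun x => max (f x - k) 0 ^ (n + 2))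
      (fun x => ((n + 2) * max (f x - k) 0 ^ (n + 1)) • Df x) := by
  have := hf.comp (contDiff_max_sub_pow k n) (by
    rw [max_eq_right (by linarith)]; simp)
  simpa only [(hasDerivAt_max_sub_pow k n _).deriv] using this

theorem sub {g : EuclideanSpace ℝ (Fin N) → ℝ}
    {Dg : EuclideanSpace ℝ (Fin N) → EuclideanSpace ℝ (Fin N)}
    (hf : IsCompactSobolev f Df) (hg : IsCompactSobolev g Dg) :
    IsCompactSobolev (fun x => f x - g x) (fun x => Df x - Dg x) := by
  refine ⟨hf.continuous.sub hg.continuous, hf.hasCompactSupport.sub hg.hasCompactSupport,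
    hf.memLp_grad.sub hg.memLp_grad, fun ψ hψ hψs e => ?_⟩
  have hd : Continuous fun x => fderiv ℝ ψ x e :=
    (hψ.continuous_fderiv (by simp)).clm_apply continuous_const
  have hi : ∀ {h : EuclideanSpace ℝ (Fin N) → ℝ}, Continuous h →
      Integrable fun x => h x * fderiv ℝ ψ x e := fun hh =>
    (hh.mul hd).integrable_of_hasCompactSupport (hψs.fderiv_apply ℝ e).mul_left
  simp only [sub_mul, inner_sub_left]
  rw [integral_sub (hi hf.continuous) (hi hg.continuous),
    integral_sub (integrable_inner_mul hf.memLp_grad hψ.continuous hψs e)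
      (integrable_inner_mul hg.memLp_grad hψ.continuous hψs e),
    hf.integral_eq ψ hψ hψs e, hg.integral_eq ψ hψ hψs e]
  ring

/-- Localization of a Sobolev function by a smooth cutoff. -/
theorem cutoff_mul {Ω : Set (EuclideanSpace ℝ (Fin N))} (hΩ : IsOpen Ω)
    {u : EuclideanSpace ℝ (Fin N) → ℝ}
    {Du : EuclideanSpace ℝ (Fin N) → EuclideanSpace ℝ (Fin N)} (hu : ContinuousOn u Ω)
    (hw : HasWeakGradient Ω u Du) (h2 : MemLpLoc 2 Ω Du)
    {η : EuclideanSpace ℝ (Fin N) → ℝ} (hη : IsTestFunction Ω η) :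
    IsCompactSobolev (fun x => η x * u x) (fun x => η x • Du x + u x • gradient η x) := by
  have hηc := hη.smooth.continuous
  have hgrad : Continuous (gradient η) :=
    (InnerProductSpace.toDual ℝ _).symm.continuous.comp (hη.smooth.continuous_fderiv (by simp))
  have hgs : tsupport (gradient η) ⊆ tsupport η := by
    have h : Function.support (gradient η) ⊆ Function.support (fderiv ℝ η) := fun x hx hx0 =>
      hx (by simp [gradient, hx0])
    exact (closure_mono h).trans (tsupport_fderiv_subset ℝ (f := η))
  have huc : ∀ x ∈ tsupport η, ContinuousAt u x := fun x hx =>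
    hu.continuousAt (hΩ.mem_nhds (hη.support_subset hx))
  have hcont : Continuous fun x => η x * u x := continuous_of_tsupport fun x hx =>
    hηc.continuousAt.mul (huc x (tsupport_mul_subset_left hx))
  have hcomp : HasCompactSupport fun x => η x * u x := hη.compact_support.mul_right
  have hcont2 : Continuous fun x => u x • gradient η x := continuous_of_tsupport fun x hx =>
    (huc x (hgs (tsupport_smul_subset_right u (gradient η) hx))).smul hgrad.continuousAt
  have hgc : HasCompactSupport (gradient η) :=
    hη.compact_support.of_isClosed_subset (isClosed_tsupport _) hgs
  have hcomp2 : HasCompactSupport fun x => u x • gradient η x := hgc.smul_left (f := u)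
  have hL2 : MemLp (fun x => η x • Du x) 2 volume := by
    have h3 := (h2 _ hη.compact_support hη.support_subset)
    obtain ⟨C, hC⟩ := hη.compact_support.exists_bound_of_continuous hηc
    have h4 : MemLp (fun x => η x • Du x) 2 (volume.restrict (tsupport η)) :=
      h3.of_le_mul (c := C) (hηc.aestronglyMeasurable.smul h3.1) (ae_of_all _ fun x => by
        rw [norm_smul]
        exact mul_le_mul_of_nonneg_right (hC x) (norm_nonneg _))
    rw [← memLp_indicator_iff_restrict (isClosed_tsupport η).measurableSet] at h4
    rwa [Set.indicator_eq_self.2] at h4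
    exact fun x hx => subset_tsupport _ (fun h => hx (by simp [h]))
  have hL2' : MemLp (fun x => u x • gradient η x) 2 volume :=
    hcont2.memLp_of_hasCompactSupport hcomp2
  refine ⟨hcont, hcomp, hL2.add hL2', fun ψ hψ hψs e => ?_⟩
  -- Testing with `η ψ`, which is supported in `Ω`, turns the local weak gradient of `u` into a
  -- global one for `η u`; the product rule produces the term `u ∇η`.
  have hprod : IsTestFunction Ω (fun x => η x * ψ x) :=
    ⟨hη.smooth.mul hψ, hη.compact_support.mul_right,
      tsupport_mul_subset_left.trans hη.support_subset⟩
  have hdψ : Continuous fun x => fderiv ℝ ψ x e :=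
    (hψ.continuous_fderiv (by simp)).clm_apply continuous_const
  have key := hw.integral_eq _ hprod e
  have hout : ∀ x, x ∉ Ω → η x = 0 ∧ gradient η x = 0 := fun x hx =>
    ⟨image_eq_zero_of_notMem_tsupport fun h => hx (hη.support_subset h),
      image_eq_zero_of_notMem_tsupport fun h => hx (hη.support_subset (hgs h))⟩
  have hd : ∀ x, fderiv ℝ (fun x => η x * ψ x) x e
      = η x * fderiv ℝ ψ x e + ψ x * inner ℝ (gradient η x) e := by
    intro x
    rw [fderiv_fun_mul ((hη.smooth.differentiable (by simp)) x) ((hψ.differentiable (by simp)) x),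
      inner_gradient_left]
    simp
  simp only [hd] at key
  rw [setIntegral_eq_integral_of_forall_compl_eq_zero (fun x hx => by simp [hout x hx]),
    setIntegral_eq_integral_of_forall_compl_eq_zero (fun x hx => by simp [hout x hx])] at key
  have hI1 : Integrable fun x => η x * u x * fderiv ℝ ψ x e :=
    (hcont.mul hdψ).integrable_of_hasCompactSupport hcomp.mul_right
  have hI2 : Integrable fun x => inner ℝ (u x • gradient η x) e * ψ x :=
    integrable_inner_mul hL2' hψ.continuous hψs e
  have hI3 : Integrable fun x => inner ℝ (η x • Du x) e * ψ x :=
    integrable_inner_mul hL2 hψ.continuous hψs e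
  have e1 : ∫ x, u x * (η x * fderiv ℝ ψ x e + ψ x * inner ℝ (gradient η x) e)
      = (∫ x, η x * u x * fderiv ℝ ψ x e) + ∫ x, inner ℝ (u x • gradient η x) e * ψ x := by
    rw [← integral_add hI1 hI2]
    refine integral_congr_ae (ae_of_all _ fun x => ?_)
    simp only [inner_smul_left, conj_trivial]
    ring
  have e2 : ∫ x, inner ℝ (Du x) e * (η x * ψ x) = ∫ x, inner ℝ (η x • Du x) e * ψ x := by
    refine integral_congr_ae (ae_of_all _ fun x => ?_)
    simp only [inner_smul_left, conj_trivial]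
    ring
  simp only [inner_add_left, add_mul]
  rw [integral_add hI3 hI2]
  rw [e1, e2] at key
  linarith


/-! ### Absorption near the maximum. -/

/-- The part of an `L^p` function living where `k < f` and `Df ≠ 0` is small in `L^p` when `k` is
close to the maximum of `f`. -/
theorem exists_eLpNorm_indicator_le (hf : IsCompactSobolev f Df) {B : EuclideanSpace ℝ (Fin N) → ℝ}
    {p : ℝ≥0∞} (hp0 : p ≠ 0) (hp : p ≠ ⊤) (hB : MemLp B p volume) {k₀ M : ℝ} (hk : k₀ < M) (hM : ∀ x, f x ≤ M)
    {ε : ℝ≥0∞} (hε : 0 < ε) :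
    ∃ k, k₀ < k ∧ k < M ∧ eLpNorm ({x | k < f x ∧ Df x ≠ 0}.indicator B) p volume ≤ ε := by
  obtain ⟨κ, -, hκ, hκl⟩ := exists_seq_strictMono_tendsto' hk
  have hms : ∀ k : ℝ, NullMeasurableSet {x | k < f x ∧ Df x ≠ 0} volume := fun k =>
    (measurableSet_lt measurable_const hf.continuous.measurable).nullMeasurableSet.inter
      (hf.memLp_grad.1.aemeasurable.nullMeasurableSet_preimage (measurableSet_singleton 0).compl)
  have hpr : 0 < p.toReal := ENNReal.toReal_pos hp0 hp
  have hlim : Tendsto (fun n => ∫⁻ x, ‖({x | κ n < f x ∧ Df x ≠ 0}.indicator B) x‖ₑ ^ p.toReal) atTop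
      (𝓝 (∫⁻ _ : EuclideanSpace ℝ (Fin N), 0)) := by
    refine tendsto_lintegral_of_dominated_convergence' (fun x => ‖B x‖ₑ ^ p.toReal)
      (fun n => ((hB.1.indicator₀ (hms _)).enorm.pow_const _)) (fun n => ae_of_all _ fun x => ?_) ?_ ?_
    · exact ENNReal.rpow_le_rpow (enorm_indicator_le_enorm_self _ _) hpr.le
    · exact (lintegral_rpow_enorm_lt_top_of_eLpNorm_lt_top hp0 hp hB.2).ne
    -- Below the maximum the point eventually leaves the set. At the maximum the gradient is zero
    -- almost everywhere, so the condition `Df x ≠ 0` excludes it even if `{f = M}` has positive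
    -- measure.
    · filter_upwards [hf.grad_eq_zero_of_level M] with x hx
      refine tendsto_const_nhds.congr' ?_
      rcases (hM x).lt_or_eq with h | h
      · filter_upwards [hκl.eventually (lt_mem_nhds h)] with n hn
        rw [Set.indicator_of_notMem (fun hh => lt_asymm hn hh.1)]
        simp [hpr]
      · filter_upwards with n
        rw [Set.indicator_of_notMem (fun hh => hh.2 (hx h))]
        simp [hpr]
  rw [lintegral_zero] at hlim
  have hlim2 := hlim.ennrpow_const (1 / p.toReal)
  rw [ENNReal.zero_rpow_of_pos (by positivity)] at hlim2
  obtain ⟨n, hn⟩ := (ENNReal.tendsto_nhds_zero.1 hlim2 ε hε).exists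
  refine ⟨κ n, (hκ n).1, (hκ n).2, ?_⟩
  rwa [eLpNorm_eq_lintegral_rpow_enorm_toReal hp0 hp]

/-- A function satisfying the energy inequality of `-Δf ≤ B |∇f|` with `B ∈ L^N` on all high
superlevel sets does not attain its upper bound. -/
theorem exists_le_of_energy_le (hN : 3 ≤ N) (hf : IsCompactSobolev f Df)
    {B : EuclideanSpace ℝ (Fin N) → ℝ} (hB : MemLp B N volume) {k₀ M : ℝ} (hk₀ : 0 ≤ k₀)
    (hk : k₀ < M) (hM : ∀ x, f x ≤ M)
    (hE : ∀ k, k₀ < k → k < M → ∫⁻ x, ‖max (f x - k) 0 • Df x‖ₑ ^ (2 : ℝ)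
      ≤ ∫⁻ x, ‖B x * (‖max (f x - k) 0 • Df x‖ * max (f x - k) 0 ^ 2)‖ₑ) :
    ∃ k < M, ∀ x, f x ≤ k := by
  have hNr : (3 : ℝ) ≤ N := by exact_mod_cast hN
  have hpos : (0 : ℝ) < 2⁻¹ - (N : ℝ)⁻¹ := by
    have : (N : ℝ)⁻¹ ≤ 3⁻¹ := by gcongr
    linarith
  -- The Sobolev exponent `2N/(N-2)`, exactly conjugate to `N` and `2` in Hölder's inequality for
  -- three factors.
  let p : NNReal := ⟨(2⁻¹ - (N : ℝ)⁻¹)⁻¹, by positivity⟩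
  have hp : (p : ℝ)⁻¹ = 2⁻¹ - (N : ℝ)⁻¹ := inv_inv _
  have hp0 : p ≠ 0 := fun h => by rw [h] at hp; simp at hp; linarith
  have hexp : (N : ℝ≥0∞)⁻¹ + (2⁻¹ + (p : ℝ≥0∞)⁻¹) = 1 := by
    have h1 : (N : NNReal)⁻¹ + (2⁻¹ + p⁻¹) = 1 := by
      rw [← NNReal.coe_inj]
      push_cast
      rw [hp]
      ring
    have h2 := congrArg (fun x : NNReal => (x : ℝ≥0∞)) h1
    simp only [ENNReal.coe_add, ENNReal.coe_one] at h2
    rwa [ENNReal.coe_inv hp0, ENNReal.coe_inv (by positivity), ENNReal.coe_inv (by norm_num)] at h2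
  obtain ⟨C, hC⟩ := exists_eLpNorm_le (by omega : 0 < N) hp
  -- `C` is the Sobolev constant and `2` comes from `∇(m²) = 2 m ∇f`; `δ` leaves half of the energy
  -- after absorption. Using `C + 1` covers `C = 0`.
  obtain ⟨δ, hδ, hδC⟩ : ∃ δ : NNReal, 0 < δ ∧ δ * (C * 2) ≤ 2⁻¹ := by
    refine ⟨(4 * (C + 1))⁻¹, by positivity, ?_⟩
    rw [inv_mul_le_iff₀ (by positivity), ← NNReal.coe_le_coe]
    push_cast
    linarith
  have hN0 : (N : ℝ≥0∞) ≠ 0 := by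
    rw [Nat.cast_ne_zero]
    omega
  obtain ⟨k, hk1, hk2, hkε⟩ := hf.exists_eLpNorm_indicator_le hN0 (ENNReal.natCast_ne_top N) hB hk
    hM (ENNReal.coe_pos.2 hδ)
  refine ⟨k, hk2, ?_⟩
  have hk0 : 0 ≤ k := by linarith
  set X : EuclideanSpace ℝ (Fin N) → EuclideanSpace ℝ (Fin N) := fun x => max (f x - k) 0 • Df x
    with hX
  have hmc : Continuous fun x => max (f x - k) 0 := by
    have := hf.continuous
    fun_prop
  have hH := hf.max_sub_pow hk0 0
  simp only [zero_add, Nat.cast_zero, pow_one] at hH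
  have hXm : MemLp X 2 volume := by
    have := hH.memLp_grad.const_smul (2⁻¹ : ℝ)
    refine this.ae_eq (ae_of_all _ fun x => ?_)
    simp [hX, smul_smul]
  have hS := hC _ _ hH
  have hS' : eLpNorm (fun x => ((2 : ℝ) * max (f x - k) 0) • Df x) 2 volume = 2 * eLpNorm X 2 volume := by
    have : (fun x => ((2 : ℝ) * max (f x - k) 0) • Df x) = (2 : ℝ) • X := by
      ext1 x
      simp [hX, smul_smul]
    rw [this, eLpNorm_const_smul, Real.enorm_eq_ofReal (by norm_num)]
    norm_num
  rw [hS'] at hS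
  have hE1 := hE k hk1 hk2
  set A : Set (EuclideanSpace ℝ (Fin N)) := {x | k < f x ∧ Df x ≠ 0} with hA
  have hAm : NullMeasurableSet A volume :=
    (measurableSet_lt measurable_const hf.continuous.measurable).nullMeasurableSet.inter
      (hf.memLp_grad.1.aemeasurable.nullMeasurableSet_preimage (measurableSet_singleton 0).compl)
  -- The factor `X` vanishes off `A`, so `B` may be restricted to the set where its norm is small.
  have hE2 : ∫⁻ x, ‖B x * (‖max (f x - k) 0 • Df x‖ * max (f x - k) 0 ^ 2)‖ₑ
      = ∫⁻ x, ‖A.indicator B x * (‖X x‖ * max (f x - k) 0 ^ 2)‖ₑ := by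
    refine lintegral_congr fun x => ?_
    by_cases hx : x ∈ A
    · rw [Set.indicator_of_mem hx]
    · rw [Set.indicator_of_notMem hx]
      have : X x = 0 := by
        by_contra h0
        refine hx ⟨?_, fun h => h0 (by simp [hX, h])⟩
        by_contra hlt
        exact h0 (by simp [hX, max_eq_right (by linarith : f x - k ≤ 0)])
      change ‖B x * (‖X x‖ * _)‖ₑ = _
      simp [this]
  have hE3 := lintegral_mul_three_le (μ := volume) (hB.1.indicator₀ hAm) hXm.1.norm
    (hmc.pow 2).aestronglyMeasurable hexp
  rw [eLpNorm_norm] at hE3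
  set Z := eLpNorm X 2 volume with hZ
  have hZt : Z ≠ ⊤ := hXm.2.ne
  have hZ2 : ∫⁻ x, ‖X x‖ₑ ^ (2 : ℝ) = Z ^ (2 : ℝ) := by
    rw [hZ, eLpNorm_eq_lintegral_rpow_enorm_toReal (by norm_num) (by norm_num), ← ENNReal.rpow_mul]
    simp
  have hfin : Z * Z ≤ 2⁻¹ * (Z * Z) := by
    calc Z * Z = ∫⁻ x, ‖X x‖ₑ ^ (2 : ℝ) := by
          rw [hZ2, ← sq, ← ENNReal.rpow_natCast]; norm_num
      _ ≤ _ := hE1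
      _ = _ := hE2
      _ ≤ _ := hE3
      _ ≤ (δ : ℝ≥0∞) * (Z * (C * (2 * Z))) := by
          gcongr
          exact hS
      _ = ((δ * (C * 2) : NNReal) : ℝ≥0∞) * (Z * Z) := by
          rw [ENNReal.coe_mul, ENNReal.coe_mul C 2, ENNReal.coe_ofNat]
          ring
      _ ≤ ((2⁻¹ : NNReal) : ℝ≥0∞) * (Z * Z) := by gcongr
      _ = 2⁻¹ * (Z * Z) := by rw [ENNReal.coe_inv (by norm_num), ENNReal.coe_ofNat]
  -- Absorption needs `Z` finite, which is why `X ∈ L²` was established beforehand.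
  have hZ0 : Z = 0 := by
    by_contra h0
    have h1 : Z * Z ≠ 0 := mul_ne_zero h0 h0
    have h2 : Z * Z ≠ ⊤ := ENNReal.mul_ne_top hZt hZt
    have h3 := ENNReal.half_lt_self h1 h2
    rw [ENNReal.div_eq_inv_mul] at h3
    exact absurd hfin (not_le.2 h3)
  rw [hZ0] at hS
  simp only [mul_zero, nonpos_iff_eq_zero] at hS
  rw [eLpNorm_eq_zero_iff hH.continuous.aestronglyMeasurable (by simpa using hp0)] at hS
  -- Zero energy and Sobolev's inequality give `m² = 0` almost everywhere; continuity makes it hold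
  -- at every point.
  have hall := (Continuous.ae_eq_iff_eq volume hH.continuous continuous_zero).1 hS
  intro x
  have := congrFun hall x
  simp only [Pi.zero_apply, ne_eq, OfNat.ofNat_ne_zero, not_false_eq_true, pow_eq_zero_iff] at this
  have h2 := le_max_left (f x - k) 0
  linarith

end IsCompactSobolev

/-! ### Elementary inequalities for powers. -/

/-- For `c = a t` with `0 ≤ t ≤ 1`, `q ≤ 2` gives `1 - t^q ≤ 1 - t² ≤ 2(1 - t)`, and `a^(q-1) ≤ 1 +
a`. The factor is linear in `a`, so the resulting coefficient has the same integrability as `∇u`. -/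
theorem Real.rpow_sub_rpow_le {a c q : ℝ} (ha : 0 ≤ a) (hc : 0 ≤ c) (hq1 : 1 < q) (hq2 : q ≤ 2) :
    a ^ q - c ^ q ≤ 2 * (1 + a) * |a - c| := by
  rcases le_or_gt a c with h | h
  · have h1 : a ^ q ≤ c ^ q := Real.rpow_le_rpow ha h (by linarith)
    have h2 : 0 ≤ 2 * (1 + a) * |a - c| := by positivity
    linarith
  · have ha0 : 0 < a := lt_of_le_of_lt hc h
    rw [abs_of_pos (sub_pos.2 h)]
    obtain ⟨t, ht0, ht1, rfl⟩ : ∃ t, 0 ≤ t ∧ t ≤ 1 ∧ c = a * t :=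
      ⟨c / a, by positivity, div_le_one_of_le₀ h.le ha, by field_simp⟩
    rw [Real.mul_rpow ha ht0]
    have h1 : t ^ 2 ≤ t ^ q := by
      rcases ht0.eq_or_lt with rfl | ht
      · rw [Real.zero_rpow (by linarith)]; norm_num
      · rw [← Real.rpow_two]
        exact Real.rpow_le_rpow_of_exponent_ge ht ht1 hq2
    have h2 : a ^ q = a ^ (q - 1) * a := by
      rw [Real.rpow_sub_one ha0.ne']; field_simp
    have h3 : a ^ (q - 1) ≤ 1 + a := by
      rcases le_total a 1 with h | h
      · exact (Real.rpow_le_one ha h (by linarith)).trans (by linarith)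
      · have := Real.rpow_le_rpow_of_exponent_le h (by linarith : q - 1 ≤ 1)
        rw [Real.rpow_one] at this
        linarith
    have h4 : (0 : ℝ) ≤ a ^ q := by positivity
    calc a ^ q - a ^ q * t ^ q ≤ a ^ q * (1 - t ^ 2) := by nlinarith
      _ ≤ a ^ q * (2 * (1 - t)) := by gcongr; nlinarith
      _ = a ^ (q - 1) * (2 * (a * (1 - t))) := by rw [h2]; ring
      _ ≤ (1 + a) * (2 * (a * (1 - t))) := by
          have : 0 ≤ 1 - t := by linarith
          gcongr
      _ = _ := by ring

theorem Real.rpow_le_one_add_sq {a q : ℝ} (ha : 0 ≤ a) (hq0 : 0 ≤ q) (hq2 : q ≤ 2) :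
    a ^ q ≤ 1 + a ^ 2 := by
  rcases le_total a 1 with h | h
  · have := Real.rpow_le_one ha h hq0
    nlinarith [sq_nonneg a]
  · have := Real.rpow_le_rpow_of_exponent_le h hq2
    rw [Real.rpow_two] at this
    linarith

/-! ### Compact superlevel sets, coefficient bounds and the energy inequality. -/

section Comparison

variable {N : ℕ} {Ω K : Set (EuclideanSpace ℝ (Fin N))}

/-- If `w` is at most `0` at the boundary in the sense of the upper limit, then its superlevel sets
in `Ω` for positive levels are compact. -/
theorem isCompact_superlevel (hΩ : IsOpen Ω) (hb : Bornology.IsBounded Ω)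
    {w : EuclideanSpace ℝ (Fin N) → ℝ} (hw : ContinuousOn w Ω)
    (h : ∀ x₀ ∈ frontier Ω, limsup (fun x => ((w x : ℝ) : EReal)) (𝓝[Ω] x₀) ≤ 0)
    {k : ℝ} (hk : 0 < k) : IsCompact {x ∈ Ω | k ≤ w x} := by
  refine Metric.isCompact_of_isClosed_isBounded (closure_subset_iff_isClosed.1 fun x hx => ?_)
    (hb.subset fun x hx => hx.1)
  have hne : (𝓝[{x ∈ Ω | k ≤ w x}] x).NeBot := mem_closure_iff_nhdsWithin_neBot.1 hx
  have hle : 𝓝[{x ∈ Ω | k ≤ w x}] x ≤ 𝓝[Ω] x := nhdsWithin_mono _ fun y hy => hy.1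
  have hev : ∀ᶠ y in 𝓝[{x ∈ Ω | k ≤ w x}] x, k ≤ w y := by
    filter_upwards [self_mem_nhdsWithin] with y hy using hy.2
  by_cases hxΩ : x ∈ Ω
  · exact ⟨hxΩ, ge_of_tendsto ((hw x hxΩ).mono_left hle) hev⟩
  · exfalso
    have hxf : x ∈ frontier Ω := by
      rw [hΩ.frontier_eq]
      exact ⟨closure_mono (fun y hy => hy.1) hx, hxΩ⟩
    -- Near a boundary point `w < k` eventually, so no sequence of the superlevel set can converge
    -- to it.
    have hlt : limsup (fun x => ((w x : ℝ) : EReal)) (𝓝[Ω] x) < (k : EReal) :=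
      lt_of_le_of_lt (h x hxf) (by exact_mod_cast hk)
    have h2 := (eventually_lt_of_limsup_lt hlt).filter_mono hle
    obtain ⟨y, hy1, hy2⟩ := (hev.and h2).exists
    exact absurd (EReal.coe_lt_coe_iff.1 hy2) (not_lt.2 hy1)

/-- The value `1` is taken near each point of `K`, not only on `K`, so that the gradient of the
cutoff vanishes there. -/
theorem exists_testFunction_eq_one (hΩ : IsOpen Ω) (hK : IsCompact K) (hKΩ : K ⊆ Ω) :
    ∃ η, IsTestFunction Ω η ∧ (∀ x, 0 ≤ η x) ∧ (∀ x, η x ≤ 1) ∧ ∀ x ∈ K, ∀ᶠ y in 𝓝 x, η y = 1 := by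
  obtain ⟨L, hL, hKL, hLΩ⟩ := exists_compact_between hK hΩ hKΩ
  obtain ⟨η, h1, h0, h01⟩ := exists_contMDiffMap_one_nhds_of_subset_interior
    (n := ⊤) (modelWithCornersSelf ℝ (EuclideanSpace ℝ (Fin N))) hK.isClosed hKL
  have hts : tsupport η ⊆ L := closure_minimal
    (fun x hx => by_contra fun hxL => hx (h0 x hxL)) hL.isClosed
  refine ⟨η, ⟨η.contMDiff.contDiff, hL.of_isClosed_subset (isClosed_tsupport _) hts, hts.trans hLΩ⟩,
    fun x => (h01 x).1, fun x => (h01 x).2, fun x hx => ?_⟩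
  exact h1.filter_mono (nhds_le_nhdsSet hx)

theorem MeasureTheory.MemLp.ae_norm_le {α F : Type*} [MeasurableSpace α] {μ : Measure α}
    [NormedAddCommGroup F] {f : α → F} (hf : MemLp f ⊤ μ) :
    ∀ᵐ x ∂μ, ‖f x‖ ≤ (eLpNorm f ⊤ μ).toReal := by
  filter_upwards [ae_le_eLpNormEssSup (f := f) (μ := μ)] with x hx
  rw [← eLpNorm_exponent_top] at hx
  rw [← toReal_enorm]
  exact ENNReal.toReal_mono hf.2.ne hx

theorem MeasureTheory.MemLp.integrable_inner_of_two {α F : Type*} [MeasurableSpace α] {μ : Measure α}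
    [NormedAddCommGroup F] [InnerProductSpace ℝ F] {X Y : α → F} (hX : MemLp X 2 μ)
    (hY : MemLp Y 2 μ) : Integrable (fun x => inner ℝ (X x) (Y x)) μ := by
  have h : Integrable (fun x => ‖X x‖ * ‖Y x‖) μ := hX.norm.integrable_mul hY.norm
  exact h.mono' (hX.1.inner hY.1) (ae_of_all _ fun x => norm_inner_le_norm _ _)

theorem MeasureTheory.MemLp.const_mul_one_add_norm {α F : Type*} [MeasurableSpace α] {μ : Measure α}
    [IsFiniteMeasure μ] [NormedAddCommGroup F] {p : ℝ≥0∞} {X : α → F} (hX : MemLp X p μ) (C : ℝ) :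
    MemLp (fun x => C * (2 * (1 + ‖X x‖))) p μ := by
  have h1 : MemLp (fun _ => (1 : ℝ)) p μ := memLp_const 1
  have h2 : MemLp (fun x => 1 + ‖X x‖) p μ := h1.add hX.norm
  exact (h2.const_mul 2).const_mul C

theorem integrable_mul_norm_mul {α F : Type*} [MeasurableSpace α] {μ : Measure α}
    [NormedAddCommGroup F] {B b : α → ℝ} {X : α → F} (hB : MemLp B 2 μ) (hX : MemLp X 2 μ)
    (hb : AEStronglyMeasurable b μ) {R : ℝ} (hR : ∀ x, |b x| ≤ R) :
    Integrable (fun x => B x * (‖X x‖ * b x)) μ := by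
  have h1 : Integrable (fun x => B x * ‖X x‖) μ := hB.integrable_mul hX.norm
  simpa only [mul_assoc] using h1.mul_bdd (c := R) hb (ae_of_all _ hR)

/-- The coefficient `g(x, u)` is bounded on compact sets when `u` is continuous and positive. -/
theorem exists_coeff_le (hK : IsCompact K) (hKΩ : K ⊆ Ω)
    {g : EuclideanSpace ℝ (Fin N) → ℝ → ℝ}
    (hg_nonneg : ∀ x ∈ Ω, ∀ s : ℝ, 0 < s → 0 ≤ g x s)
    (hg_anti : ∀ᵐ x ∂(volume.restrict Ω), AntitoneOn (g x) (Set.Ioi 0))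
    (hg_bdd : ∀ s : ℝ, 0 < s → MemLpLoc ⊤ Ω (fun x => g x s))
    {u : EuclideanSpace ℝ (Fin N) → ℝ} (hu : ContinuousOn u Ω) (hu_pos : ∀ x ∈ Ω, 0 < u x) :
    ∃ C, 0 ≤ C ∧ ∀ᵐ x ∂(volume.restrict K), |g x (u x)| ≤ C := by
  rcases K.eq_empty_or_nonempty with rfl | hne
  · exact ⟨0, le_rfl, by simp⟩
  -- Monotonicity gives `g(x, u(x)) ≤ g(x, min u)` on `K`, and with a constant second argument `g`
  -- is essentially bounded there.
  obtain ⟨x₀, hx₀, hmin⟩ := hK.exists_isMinOn hne (hu.mono hKΩ)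
  have h0 := hu_pos x₀ (hKΩ hx₀)
  refine ⟨_, ENNReal.toReal_nonneg (a := eLpNorm (fun x => g x (u x₀)) ⊤ (volume.restrict K)), ?_⟩
  filter_upwards [(hg_bdd _ h0 K hK hKΩ).ae_norm_le,
    ae_mono (Measure.restrict_mono hKΩ le_rfl) hg_anti, ae_restrict_mem hK.measurableSet]
    with x h1 h2 hx
  have hux := hu_pos x (hKΩ hx)
  rw [abs_of_nonneg (hg_nonneg x (hKΩ hx) _ hux)]
  exact (h2 h0 hux (hmin hx)).trans ((le_abs_self _).trans h1)

/-- On `K` the coefficient is bounded and `|∇u|^q ≤ 1 + |∇u|²`, which is integrable; outside `K` the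
test function vanishes. -/
theorem integrableOn_coeff_mul (hΩ : IsOpen Ω) (hK : IsCompact K) (hKΩ : K ⊆ Ω)
    {q : ℝ} (hq0 : 0 ≤ q) (hq2 : q ≤ 2) {c φ : EuclideanSpace ℝ (Fin N) → ℝ}
    {Du : EuclideanSpace ℝ (Fin N) → EuclideanSpace ℝ (Fin N)}
    (hm : AEStronglyMeasurable (fun x => c x * ‖Du x‖ ^ q) (volume.restrict Ω))
    {C : ℝ} (hC0 : 0 ≤ C) (hC : ∀ᵐ x ∂(volume.restrict K), |c x| ≤ C)
    (hDu : MemLp Du 2 (volume.restrict K)) (hφ : Continuous φ) (hφK : ∀ x, x ∉ K → φ x = 0) :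
    IntegrableOn (fun x => c x * ‖Du x‖ ^ q * φ x) Ω volume := by
  have hKf : IsFiniteMeasure (volume.restrict K) := ⟨by simpa using hK.measure_lt_top⟩
  refine IntegrableOn.of_forall_sdiff_eq_zero (s := K) ?_ hΩ.measurableSet
    fun x hx => by rw [hφK x hx.2, mul_zero]
  obtain ⟨R, hR⟩ := hK.exists_bound_of_continuousOn hφ.continuousOn
  have hbase : IntegrableOn (fun x => c x * ‖Du x‖ ^ q) K volume := by
    have hsq : Integrable (fun x => C * (1 + ‖Du x‖ ^ 2)) (volume.restrict K) :=
      ((integrable_const 1).add (hDu.integrable_norm_pow (by norm_num))).const_mul C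
    refine hsq.mono' (hm.mono_measure (Measure.restrict_mono hKΩ le_rfl)) ?_
    filter_upwards [hC] with x hx
    rw [norm_mul, Real.norm_of_nonneg (by positivity : 0 ≤ ‖Du x‖ ^ q)]
    exact mul_le_mul hx (Real.rpow_le_one_add_sq (norm_nonneg _) hq0 hq2) (by positivity) hC0
  refine hbase.mul_bdd (c := R) hφ.aestronglyMeasurable ?_
  filter_upwards [ae_restrict_mem hK.measurableSet] with x hx using hR x hx

/-- The energy inequality obtained by testing both inequalities with `((f - k)⁺)³`, where `f`
agrees with `u - v` on its superlevel set `{k₀ < f}`. -/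
theorem energy_le (hΩ : IsOpen Ω) {q lam : ℝ} (hq1 : 1 < q) (hq2 : q ≤ 2)
    (hlam : lam ≤ 0) {h : EuclideanSpace ℝ (Fin N) → ℝ}
    {g : EuclideanSpace ℝ (Fin N) → ℝ → ℝ}
    (hg_nonneg : ∀ x ∈ Ω, ∀ s : ℝ, 0 < s → 0 ≤ g x s)
    (hg_anti : ∀ᵐ x ∂(volume.restrict Ω), AntitoneOn (g x) (Set.Ioi 0))
    {u v : EuclideanSpace ℝ (Fin N) → ℝ}
    {Du Dv : EuclideanSpace ℝ (Fin N) → EuclideanSpace ℝ (Fin N)}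
    (hu_cont : ContinuousOn u Ω) (hv_cont : ContinuousOn v Ω)
    (hu_pos : ∀ x ∈ Ω, 0 < u x) (hv_pos : ∀ x ∈ Ω, 0 < v x)
    (hu_meas : AEStronglyMeasurable (fun x => g x (u x) * ‖Du x‖ ^ q) (volume.restrict Ω))
    (hv_meas : AEStronglyMeasurable (fun x => g x (v x) * ‖Dv x‖ ^ q) (volume.restrict Ω))
    (hu_sub : IsWeakSubsolution Ω q lam g h u Du)
    (hv_super : IsWeakSupersolution Ω q lam g h v Dv)
    (hK : IsCompact K) (hKΩ : K ⊆ Ω)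
    (hDu : MemLp Du 2 (volume.restrict K)) (hDv : MemLp Dv 2 (volume.restrict K))
    {C : ℝ} (hC0 : 0 ≤ C) (hCu : ∀ᵐ x ∂(volume.restrict K), |g x (u x)| ≤ C)
    (hCv : ∀ᵐ x ∂(volume.restrict K), |g x (v x)| ≤ C)
    {f : EuclideanSpace ℝ (Fin N) → ℝ}
    {Df : EuclideanSpace ℝ (Fin N) → EuclideanSpace ℝ (Fin N)} (hf : IsCompactSobolev f Df)
    (hfΩ : tsupport f ⊆ Ω) {k₀ k : ℝ} (hk₀ : 0 ≤ k₀) (hk : k₀ < k)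
    (hloc : ∀ x, k₀ < f x → x ∈ K ∧ f x = u x - v x ∧ Df x = Du x - Dv x) :
    ∫⁻ x, ‖max (f x - k) 0 • Df x‖ₑ ^ (2 : ℝ) ≤
      ∫⁻ x, ‖K.indicator (fun x => C * (2 * (1 + ‖Du x‖))) x *
        (‖max (f x - k) 0 • Df x‖ * max (f x - k) 0 ^ 2)‖ₑ := by
  have hKf : IsFiniteMeasure (volume.restrict K) := ⟨by simpa using hK.measure_lt_top⟩
  have hfc := hf.continuous
  have hmc : Continuous fun x => max (f x - k) 0 := by fun_prop
  have hm0 : ∀ x, 0 ≤ max (f x - k) 0 := fun x => le_max_right _ _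
  have hmK : ∀ x, x ∉ K → max (f x - k) 0 = 0 := fun x hx => by
    refine max_eq_right ?_
    by_contra hlt
    exact hx (hloc x (by linarith)).1
  -- The cube, since its exponent is `1 + 2`. Its gradient `3 m² Df` pairs with `Df` to `3 |m Df|²`,
  -- and on the other side `m³ |Df| = |m Df| m²`, with `m²` the function to which Sobolev's
  -- inequality applies.
  have hφ := hf.max_sub_pow (hk₀.trans hk.le) 1
  set φ : EuclideanSpace ℝ (Fin N) → ℝ := fun x => max (f x - k) 0 ^ (1 + 2) with hφdef
  set Dφ : EuclideanSpace ℝ (Fin N) → EuclideanSpace ℝ (Fin N) :=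
    fun x => (((1 : ℕ) + 2 : ℝ) * max (f x - k) 0 ^ (1 + 1)) • Df x with hDφdef
  have hφ0 : ∀ x, 0 ≤ φ x := fun x => pow_nonneg (hm0 x) _
  have hφK : ∀ x, x ∉ K → φ x = 0 := fun x hx => by simp [hφdef, hmK x hx]
  have hDφK : ∀ x, x ∉ K → Dφ x = 0 := fun x hx => by simp [hDφdef, hmK x hx]
  have hadm : IsAdmissible Ω φ Dφ := by
    refine hφ.isAdmissible hφ0 hΩ ((closure_minimal ?_ (isClosed_tsupport f)).trans hfΩ)
    intro x hx
    by_contra hxf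
    refine hx ?_
    have : f x = 0 := image_eq_zero_of_notMem_tsupport hxf
    simp [hφdef, this, max_eq_right (by linarith : -k ≤ 0)]
  have hsub := hu_sub φ Dφ hadm
  have hsup := hv_super φ Dφ hadm
  have hext : ∀ {F : EuclideanSpace ℝ (Fin N) → ℝ}, IntegrableOn F K volume →
      (∀ x, x ∉ K → F x = 0) → IntegrableOn F Ω volume := fun hF h0 =>
    hF.of_forall_sdiff_eq_zero hΩ.measurableSet fun x hx => h0 x hx.2
  have hIgrad : ∀ {X : EuclideanSpace ℝ (Fin N) → EuclideanSpace ℝ (Fin N)},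
      MemLp X 2 (volume.restrict K) → IntegrableOn (fun x => inner ℝ (X x) (Dφ x)) Ω volume :=
    fun hX => hext (hX.integrable_inner_of_two (hφ.memLp_grad.restrict K))
      fun x hx => by rw [hDφK x hx, inner_zero_right]
  have hIval : ∀ {y : EuclideanSpace ℝ (Fin N) → ℝ}, ContinuousOn y Ω →
      IntegrableOn (fun x => y x * φ x) Ω volume := fun hy =>
    hext (((hy.mono hKΩ).mul hφ.continuous.continuousOn).integrableOn_compact hK)
      fun x hx => by rw [hφK x hx, mul_zero]
  have hIu := integrableOn_coeff_mul hΩ hK hKΩ (by linarith) hq2 hu_meas hC0 hCu hDu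
    hφ.continuous hφK
  have hIv := integrableOn_coeff_mul hΩ hK hKΩ (by linarith) hq2 hv_meas hC0 hCv hDv
    hφ.continuous hφK
  have hX : MemLp (fun x => max (f x - k) 0 • Df x) 2 volume := by
    obtain ⟨R, hR⟩ := hf.exists_abs_comp_le (G := fun t => max (t - k) 0) (by fun_prop)
    refine hf.memLp_grad.of_le_mul (c := R) (hmc.aestronglyMeasurable.smul hf.memLp_grad.1)
      (ae_of_all _ fun x => ?_)
    rw [norm_smul]
    exact mul_le_mul_of_nonneg_right (hR x) (norm_nonneg _)
  have hIB : IntegrableOn (fun x => K.indicator (fun x => C * (2 * (1 + ‖Du x‖))) x *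
      (‖max (f x - k) 0 • Df x‖ * max (f x - k) 0 ^ 2)) Ω volume := by
    refine hext ?_ fun x hx => by simp [hmK x hx]
    have hB : MemLp (K.indicator fun x => C * (2 * (1 + ‖Du x‖))) 2 (volume.restrict K) :=
      (hDu.const_mul_one_add_norm C).indicator hK.measurableSet
    obtain ⟨R, hR⟩ := hf.exists_abs_comp_le (G := fun t => max (t - k) 0 ^ 2) (by fun_prop)
    exact integrable_mul_norm_mul hB (hX.restrict K) (hmc.pow 2).aestronglyMeasurable hR
  have hgrad : ∫ x in Ω, 3 * ‖max (f x - k) 0 • Df x‖ ^ 2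
      = (∫ x in Ω, inner ℝ (Du x) (Dφ x)) - ∫ x in Ω, inner ℝ (Dv x) (Dφ x) := by
    rw [← integral_sub (hIgrad hDu) (hIgrad hDv)]
    refine integral_congr_ae (ae_of_all _ fun x => ?_)
    simp only [← inner_sub_left]
    by_cases hx : k₀ < f x
    · rw [← (hloc x hx).2.2]
      simp only [hDφdef, inner_smul_right, real_inner_self_eq_norm_sq, norm_smul,
        Real.norm_of_nonneg (hm0 x)]
      push_cast
      ring
    · have : max (f x - k) 0 = 0 := max_eq_right (by linarith)
      simp [hDφdef, this]
  have hval : 0 ≤ (∫ x in Ω, u x * φ x) - ∫ x in Ω, v x * φ x := by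
    rw [← integral_sub (hIval hu_cont) (hIval hv_cont)]
    refine integral_nonneg fun x => ?_
    simp only [Pi.zero_apply, ← sub_mul]
    by_cases hx : k₀ < f x
    · rw [← (hloc x hx).2.1]
      exact mul_nonneg (by linarith) (hφ0 x)
    · have : max (f x - k) 0 = 0 := max_eq_right (by linarith)
      simp [hφdef, this]
  have hcoef : (∫ x in Ω, g x (u x) * ‖Du x‖ ^ q * φ x) - (∫ x in Ω, g x (v x) * ‖Dv x‖ ^ q * φ x)
      ≤ ∫ x in Ω, K.indicator (fun x => C * (2 * (1 + ‖Du x‖))) x *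
        (‖max (f x - k) 0 • Df x‖ * max (f x - k) 0 ^ 2) := by
    rw [← integral_sub hIu hIv]
    refine integral_mono_ae (hIu.sub hIv) hIB ?_
    have hCu' : ∀ᵐ x ∂(volume.restrict Ω), x ∈ K → |g x (u x)| ≤ C :=
      ae_restrict_of_ae ((ae_restrict_iff' hK.measurableSet).1 hCu)
    filter_upwards [hg_anti, hCu'] with x hanti hCx
    by_cases hx : k₀ < f x
    · obtain ⟨hxK, hfx, hDfx⟩ := hloc x hx
      have hux := hu_pos x (hKΩ hxK)
      have hvx := hv_pos x (hKΩ hxK)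
      have hgu := hg_nonneg x (hKΩ hxK) _ hux
      have hguv : g x (u x) ≤ g x (v x) := hanti hvx hux (by linarith)
      have hguC : g x (u x) ≤ C := (le_abs_self _).trans (hCx hxK)
      have hd : |‖Du x‖ - ‖Dv x‖| ≤ ‖Df x‖ := by
        rw [hDfx]
        exact abs_norm_sub_norm_le _ _
      have hpow := Real.rpow_sub_rpow_le (norm_nonneg (Du x)) (norm_nonneg (Dv x)) hq1 hq2
      have h1 : g x (u x) * ‖Du x‖ ^ q - g x (v x) * ‖Dv x‖ ^ q
          ≤ C * (2 * (1 + ‖Du x‖)) * ‖Df x‖ := by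
        -- Replacing `g(x,v)` by the smaller `g(x,u)` is where monotonicity enters; it leaves a
        -- difference of powers with one bounded coefficient.
        calc g x (u x) * ‖Du x‖ ^ q - g x (v x) * ‖Dv x‖ ^ q
            ≤ g x (u x) * ‖Du x‖ ^ q - g x (u x) * ‖Dv x‖ ^ q := by gcongr
          _ = g x (u x) * (‖Du x‖ ^ q - ‖Dv x‖ ^ q) := by ring
          _ ≤ g x (u x) * (2 * (1 + ‖Du x‖) * |‖Du x‖ - ‖Dv x‖|) := by gcongr
          _ ≤ C * (2 * (1 + ‖Du x‖) * ‖Df x‖) := by gcongr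
          _ = _ := by ring
      rw [Set.indicator_of_mem hxK, norm_smul, Real.norm_of_nonneg (hm0 x)]
      have h2 := mul_le_mul_of_nonneg_right h1 (hφ0 x)
      calc _ = (g x (u x) * ‖Du x‖ ^ q - g x (v x) * ‖Dv x‖ ^ q) * φ x := by ring
        _ ≤ _ := h2
        _ = _ := by simp only [hφdef]; ring
    · have : max (f x - k) 0 = 0 := max_eq_right (by linarith)
      simp [hφdef, this]
  -- Subtracting the two tested inequalities cancels the integral of `h φ`, and the zeroth-order
  -- term is nonpositive.
  have hmain : ∫ x in Ω, 3 * ‖max (f x - k) 0 • Df x‖ ^ 2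
      ≤ ∫ x in Ω, K.indicator (fun x => C * (2 * (1 + ‖Du x‖))) x *
        (‖max (f x - k) 0 • Df x‖ * max (f x - k) 0 ^ 2) := by
    rw [hgrad]
    have := mul_nonpos_of_nonpos_of_nonneg hlam hval
    rw [mul_sub] at this
    linarith
  have hsq : Integrable (fun x => ‖max (f x - k) 0 • Df x‖ ^ 2) volume :=
    hX.integrable_norm_pow (by norm_num)
  have hΩall : ∫ x in Ω, ‖max (f x - k) 0 • Df x‖ ^ 2 = ∫ x, ‖max (f x - k) 0 • Df x‖ ^ 2 :=
    setIntegral_eq_integral_of_forall_compl_eq_zero fun x hx => by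
      simp [hmK x fun h => hx (hKΩ h)]
  rw [integral_const_mul, hΩall] at hmain
  -- Nonnegativity allows the factor `3` to be dropped.
  have hnn : 0 ≤ ∫ x, ‖max (f x - k) 0 • Df x‖ ^ 2 := integral_nonneg fun x => sq_nonneg _
  calc ∫⁻ x, ‖max (f x - k) 0 • Df x‖ₑ ^ (2 : ℝ)
      = ENNReal.ofReal (∫ x, ‖max (f x - k) 0 • Df x‖ ^ 2) := by
        rw [ofReal_integral_eq_lintegral_ofReal hsq (ae_of_all _ fun x => sq_nonneg _)]
        refine lintegral_congr fun x => ?_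
        rw [ENNReal.ofReal_pow (norm_nonneg _), ofReal_norm, ENNReal.rpow_two]
    _ ≤ ENNReal.ofReal (∫ x in Ω, K.indicator (fun x => C * (2 * (1 + ‖Du x‖))) x *
        (‖max (f x - k) 0 • Df x‖ * max (f x - k) 0 ^ 2)) :=
        ENNReal.ofReal_le_ofReal (by linarith)
    _ ≤ ‖∫ x in Ω, K.indicator (fun x => C * (2 * (1 + ‖Du x‖))) x *
        (‖max (f x - k) 0 • Df x‖ * max (f x - k) 0 ^ 2)‖ₑ := Real.ofReal_le_enorm _
    _ ≤ ∫⁻ x in Ω, ‖K.indicator (fun x => C * (2 * (1 + ‖Du x‖))) x *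
        (‖max (f x - k) 0 • Df x‖ * max (f x - k) 0 ^ 2)‖ₑ := enorm_integral_le_lintegral_enorm _
    _ ≤ _ := setLIntegral_le_lintegral _ _

end Comparison

/-! ### The comparison principle. -/

theorem MemLpLoc.mono_exponent {N : ℕ} {F : Type*} [NormedAddCommGroup F] {p q : ℝ≥0∞}
    {Ω : Set (EuclideanSpace ℝ (Fin N))} {f : EuclideanSpace ℝ (Fin N) → F}
    (hf : MemLpLoc q Ω f) (hpq : p ≤ q) : MemLpLoc p Ω f := fun K hK hKΩ =>
  have : IsFiniteMeasure (volume.restrict K) := ⟨by simpa using hK.measure_lt_top⟩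
  (hf K hK hKΩ).mono_exponent hpq

theorem theorem2p1 {N : ℕ} (hN : 3 ≤ N) (Ω : Set (EuclideanSpace ℝ (Fin N)))
    (hΩ_open : IsOpen Ω) (hΩ_conn : IsConnected Ω) (hΩ_bdd : Bornology.IsBounded Ω)
    (q lam : ℝ) (hq1 : 1 < q) (hq2 : q ≤ 2) (hlam : lam ≤ 0)
    (h : EuclideanSpace ℝ (Fin N) → ℝ) (hh : MemLpLoc 1 Ω h)
    (g : EuclideanSpace ℝ (Fin N) → ℝ → ℝ)
    (hg_nonneg : ∀ x ∈ Ω, ∀ s : ℝ, 0 < s → 0 ≤ g x s)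
    (hg_anti : ∀ᵐ x ∂(volume.restrict Ω), AntitoneOn (g x) (Set.Ioi 0))
    (hg_bdd : ∀ s : ℝ, 0 < s → MemLpLoc ∞ Ω (fun x => g x s))
    (u v : EuclideanSpace ℝ (Fin N) → ℝ)
    (Du Dv : EuclideanSpace ℝ (Fin N) → EuclideanSpace ℝ (Fin N))
    (hu_cont : ContinuousOn u Ω) (hv_cont : ContinuousOn v Ω)
    (hu_sob : MemW1pLoc (N : ℝ≥0∞) Ω u Du) (hv_sob : MemW1pLoc (N : ℝ≥0∞) Ω v Dv)
    (hu_pos : ∀ x ∈ Ω, 0 < u x) (hv_pos : ∀ x ∈ Ω, 0 < v x)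
    (hu_meas : AEStronglyMeasurable (fun x => g x (u x) * ‖Du x‖ ^ q) (volume.restrict Ω))
    (hv_meas : AEStronglyMeasurable (fun x => g x (v x) * ‖Dv x‖ ^ q) (volume.restrict Ω))
    (hu_sub : IsWeakSubsolution Ω q lam g h u Du)
    (hv_super : IsWeakSupersolution Ω q lam g h v Dv)
    (h_bdry : ∀ x₀ ∈ frontier Ω,
      limsup (fun x => ((u x - v x : ℝ) : EReal)) (𝓝[Ω] x₀) ≤ 0) :
    ∀ x ∈ Ω, u x ≤ v x := by
  by_contra hcon
  push Not at hcon
  obtain ⟨x₁, hx₁, hlt⟩ := hcon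
  -- Half the excess at `x₁`: positive, so the superlevel set is compact, and strictly below the
  -- maximum, so there is room for levels `k`.
  obtain ⟨k₀, hk₀⟩ : ∃ k₀, k₀ = (u x₁ - v x₁) / 2 := ⟨_, rfl⟩
  have hk₀pos : 0 < k₀ := by linarith
  have hwc : ContinuousOn (fun x => u x - v x) Ω := hu_cont.sub hv_cont
  have hK := isCompact_superlevel hΩ_open hΩ_bdd hwc h_bdry hk₀pos
  set K := {x ∈ Ω | k₀ ≤ u x - v x} with hKdef
  have hKΩ : K ⊆ Ω := fun x hx => hx.1
  have hx₁K : x₁ ∈ K := ⟨hx₁, by linarith⟩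
  obtain ⟨xM, hxM, hmax⟩ := hK.exists_isMaxOn ⟨x₁, hx₁K⟩ (hwc.mono hKΩ)
  have hkM : k₀ < u xM - v xM := by
    have := hmax hx₁K
    simp only [Set.mem_ofPred_eq] at this
    linarith
  obtain ⟨η, hη, hη0, hη1, hηK⟩ := exists_testFunction_eq_one hΩ_open hK hKΩ
  have h2N : (2 : ℝ≥0∞) ≤ N := by exact_mod_cast (by omega : 2 ≤ N)
  have hDu2 := hu_sob.memLpLoc_grad.mono_exponent h2N
  have hDv2 := hv_sob.memLpLoc_grad.mono_exponent h2N
  have hf := (IsCompactSobolev.cutoff_mul hΩ_open hu_cont hu_sob.hasWeakGradient hDu2 hη).sub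
    (IsCompactSobolev.cutoff_mul hΩ_open hv_cont hv_sob.hasWeakGradient hDv2 hη)
  set f : EuclideanSpace ℝ (Fin N) → ℝ := fun x => η x * u x - η x * v x with hfdef
  set Df : EuclideanSpace ℝ (Fin N) → EuclideanSpace ℝ (Fin N) := fun x =>
    (η x • Du x + u x • gradient η x) - (η x • Dv x + v x • gradient η x) with hDfdef
  have hfη : ∀ x, f x = η x * (u x - v x) := fun x => by simp only [hfdef]; ring
  have hηΩ : ∀ x, x ∉ Ω → η x = 0 := fun x hx =>
    image_eq_zero_of_notMem_tsupport fun h => hx (hη.support_subset h)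
  have hfΩ : tsupport f ⊆ Ω := by
    refine (closure_mono ?_).trans hη.support_subset
    intro x hx h0
    exact hx (by rw [hfη, h0, zero_mul])
  have hlocK : ∀ x ∈ K, f x = u x - v x ∧ Df x = Du x - Dv x := by
    intro x hx
    have h1 : η x = 1 := (hηK x hx).self_of_nhds
    have h2 : gradient η x = 0 := by
      have : η =ᶠ[𝓝 x] fun _ => 1 := hηK x hx
      rw [this.gradient_eq]
      simp
    exact ⟨by rw [hfη, h1, one_mul], by simp [hDfdef, h1, h2]⟩
  -- Because `0 ≤ η ≤ 1`, the cutoff cannot lift a value below `k₀` above it; hence above level `k₀`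
  -- the function `f` is `u - v` itself.
  have hmemK : ∀ x, k₀ < f x → x ∈ K := by
    intro x hx
    rw [hfη] at hx
    have hxΩ : x ∈ Ω := by
      by_contra h0
      rw [hηΩ x h0, zero_mul] at hx
      linarith
    refine ⟨hxΩ, ?_⟩
    by_contra! hw
    have h3 : η x * (u x - v x) ≤ η x * k₀ := mul_le_mul_of_nonneg_left hw.le (hη0 x)
    have h4 : η x * k₀ ≤ 1 * k₀ := mul_le_mul_of_nonneg_right (hη1 x) hk₀pos.le
    linarith
  have hfM : ∀ x, f x ≤ u xM - v xM := by
    intro x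
    by_cases hx : k₀ < f x
    · rw [(hlocK x (hmemK x hx)).1]
      exact hmax (hmemK x hx)
    · linarith
  obtain ⟨Cu, hCu0, hCu⟩ := exists_coeff_le hK hKΩ hg_nonneg hg_anti hg_bdd hu_cont hu_pos
  obtain ⟨Cv, hCv0, hCv⟩ := exists_coeff_le hK hKΩ hg_nonneg hg_anti hg_bdd hv_cont hv_pos
  have hB : MemLp (K.indicator fun x => max Cu Cv * (2 * (1 + ‖Du x‖))) N volume := by
    have : IsFiniteMeasure (volume.restrict K) := ⟨by simpa using hK.measure_lt_top⟩
    rw [memLp_indicator_iff_restrict hK.measurableSet]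
    exact (hu_sob.memLpLoc_grad K hK hKΩ).const_mul_one_add_norm _
  have hE : ∀ k, k₀ < k → k < u xM - v xM → ∫⁻ x, ‖max (f x - k) 0 • Df x‖ₑ ^ (2 : ℝ) ≤
      ∫⁻ x, ‖K.indicator (fun x => max Cu Cv * (2 * (1 + ‖Du x‖))) x *
        (‖max (f x - k) 0 • Df x‖ * max (f x - k) 0 ^ 2)‖ₑ := fun k hk0 _ =>
    energy_le hΩ_open hq1 hq2 hlam hg_nonneg hg_anti hu_cont hv_cont hu_pos hv_pos hu_meas hv_meas
      hu_sub hv_super hK hKΩ (hDu2 K hK hKΩ) (hDv2 K hK hKΩ) (hCu0.trans (le_max_left Cu Cv))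
      (hCu.mono fun x hx => hx.trans (le_max_left _ _))
      (hCv.mono fun x hx => hx.trans (le_max_right _ _)) hf hfΩ hk₀pos.le hk0
      fun x hx => ⟨hmemK x hx, hlocK x (hmemK x hx)⟩
  -- The bound by some `k` below the maximum fails at `xM`, where the maximum is attained.
  obtain ⟨k, hk, hle⟩ := hf.exists_le_of_energy_le hN hB hk₀pos.le hkM hfM hE
  have := hle xM
  rw [(hlocK xM hxM).1] at this
  linarith
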